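/- Model. An oriented ring has $n\ge 1$ nodes, indexed by $\mathbb Z/n\mathbb Z$; node $i$ has a clockwise port leading to node $i+1$ and a counterclockwise port leading to node $i-1$ (for $n=1$ these are self-loops, for $n=2$ parallel edges). A message sent through the clockwise port of a node arrives at the counterclockwise port of the neighbour, and vice versa. An asynchronous deterministic algorithm on rings is uniform and event-driven: all nodes run the same state machine; a node acts once in the beginning, as a function of its own ID and its own input, and afterwards only upon receiving a message through one of its ports; each time it changes its state and sends finitely many messages through each of its ports, and every state shows a current output. Channels are FIFO, never lose, inject or alter messages (beyond the erasure described below), and have arbitrary finite delays; thus an execution is any sequence of single message deliveries in which every channel holding a message in transit eventually makes a delivery. A node has terminated when it is in a state in which it ignores all incoming messages and sends none. The execution is quiescent when no message is in transit. In a fully defective network the content of every message is erased, so that an algorithm there (a content-oblivious algorithm) exchanges only contentless pulses. Statement. Let $A$ be any asynchronous algorithm on rings, with arbitrary inputs, states and outputs and with messages from a countable set (e.g. finite bit strings). Then there are a content-oblivious algorithm $B$ and a map $\mathrm{sim}$ from the local states of $B$ to the local states of $A$, both depending only on $A$ (in particular not on $n$, the IDs or the inputs), such that the output of $B$ in each state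 $x$ is the output of $A$ in the state $\mathrm{sim}(x)$, and such that, for every $n\ge1$, every oriented ring of $n$ nodes with pairwise distinct IDs in $\mathbb N$, every assignment of inputs and every execution of $B$ on that fully defective ring, there is an execution of $A$, on the same ring with the same IDs and inputs and with reliable content-carrying messages, for which: 1. at every time, the state of every node in the execution of $B$ is mapped by $\mathrm{sim}$ to its state in the execution of $A$ (at each time step of either execution at most one message is delivered, possibly none); 2. if all nodes eventually terminate in the execution of $A$, then all nodes eventually terminate in the execution of $B$; 3. if the execution of $A$ reaches quiescence, then the execution of $B$ reaches quiescence. -/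

import Mathlib

universe u v w s

/-- The two ports of a node of an oriented ring: `cw` leads to the clockwise neighbour,
`ccw` to the counterclockwise neighbour. -/
inductive Port where
  | ccw : Port
  | cw : Port
  deriving DecidableEq

/-- A message sent through port `p` arrives at the port `p.opp` of the neighbour. -/
def Port.opp : Port → Port
  | Port.ccw => Port.cw
  | Port.cw => Port.ccw

/-- The neighbour reached through a port in the oriented ring with node set `ZMod n`
(a ring of one node has two self-loops, a ring of two nodes two parallel edges). -/
def neighbor {n : ℕ} (i : ZMod n) : Port → ZMod n
  | Port.ccw => i - 1
  | Port.cw => i + 1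

/-- A (uniform, event-driven) asynchronous algorithm on rings, run by every node.
A node acts once in the beginning, as a function of its own identifier and its own input, and
from then on only when a message arrives at one of its ports. Each time it changes its state and
sends, through each port, a finite sequence of messages. `output` is the output that a node
currently shows. -/
structure RingAlgorithm (Input : Type u) (Msg : Type v) (Output : Type w) where
  /-- local states -/
  State : Type s
  /-- the act in the beginning -/
  init : ℕ → Input → State × (Port → List Msg)
  /-- the reaction to a message arriving at a port -/
  step : State → Port → Msg → State × (Port → List Msg)
  /-- the output shown in a state -/
  output : State → Output

/-- The only message of a fully defective network: it carries no content. -/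
abbrev Pulse : Type := Unit

namespace RingAlgorithm

variable {Input : Type u} {Msg : Type v} {Output : Type w}

/-- A node in a terminating state ignores all incoming messages and does not send any. -/
def Terminated (A : RingAlgorithm.{u, v, w, s} Input Msg Output) (x : A.State) : Prop :=
  ∀ (p : Port) (m : Msg), A.step x p m = (x, fun _ => [])

/-- A global configuration: the states of the nodes, and for every node `i` and port `p` the
messages in transit that `i` has sent through `p`, oldest first. -/
structure Config (A : RingAlgorithm.{u, v, w, s} Input Msg Output) (n : ℕ) where
  state : ZMod n → A.State
  chan : ZMod n → Port → List Msg

/-- The configuration after all nodes have acted in the beginning. -/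
def initConfig (A : RingAlgorithm.{u, v, w, s} Input Msg Output) {n : ℕ}
    (ids : ZMod n → ℕ) (inp : ZMod n → Input) : A.Config n where
  state i := (A.init (ids i) (inp i)).1
  chan i p := (A.init (ids i) (inp i)).2 p

/-- Delivery of the oldest message in transit on the channel leaving node `i` through port `p`
(nothing happens if there is none). -/
def deliver (A : RingAlgorithm.{u, v, w, s} Input Msg Output) {n : ℕ}
    (c : A.Config n) (i : ZMod n) (p : Port) : A.Config n :=
  match c.chan i p with
  | [] => c
  | m :: rest =>
    let j := neighbor i p
    let r := A.step (c.state j) p.opp m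
    { state := fun k => if k = j then r.1 else c.state k
      chan := fun k q =>
        (if k = i ∧ q = p then rest else c.chan k q) ++ (if k = j then r.2 q else []) }

/-- A schedule says which channel makes a delivery at each time, if any. -/
abbrev Schedule (n : ℕ) : Type := ℕ → Option (ZMod n × Port)

/-- The execution determined by a schedule: the configuration at each time. -/
def run (A : RingAlgorithm.{u, v, w, s} Input Msg Output) {n : ℕ}
    (ids : ZMod n → ℕ) (inp : ZMod n → Input) (sched : Schedule n) : ℕ → A.Config n
  | 0 => A.initConfig ids inp
  | t + 1 =>
    match sched t with
    | none => A.run ids inp sched t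
    | some (i, p) => A.deliver (A.run ids inp sched t) i p

/-- All delays are finite: a channel with messages in transit eventually makes a delivery. -/
def Fair (A : RingAlgorithm.{u, v, w, s} Input Msg Output) {n : ℕ}
    (ids : ZMod n → ℕ) (inp : ZMod n → Input) (sched : Schedule n) : Prop :=
  ∀ (t : ℕ) (i : ZMod n) (p : Port), (A.run ids inp sched t).chan i p ≠ [] →
    ∃ t', t ≤ t' ∧ sched t' = some (i, p)

/-- From some time on every node is in a terminating state. -/
def Terminates (A : RingAlgorithm.{u, v, w, s} Input Msg Output) {n : ℕ}
    (ids : ZMod n → ℕ) (inp : ZMod n → Input) (sched : Schedule n) : Prop :=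
  ∃ t, ∀ i, A.Terminated ((A.run ids inp sched t).state i)

/-- At some time (and hence from then on) no message is in transit. -/
def ReachesQuiescence (A : RingAlgorithm.{u, v, w, s} Input Msg Output) {n : ℕ}
    (ids : ZMod n → ℕ) (inp : ZMod n → Input) (sched : Schedule n) : Prop :=
  ∃ t, ∀ i p, (A.run ids inp sched t).chan i p = []

/-- On the given ring, every execution of the content-oblivious algorithm `B` in the fully
defective network simulates, through the local map `sim` that reads off the simulated state of a
node from its actual state, an execution of `A` in the network with reliable messages. -/
def Simulates (B : RingAlgorithm.{u, 0, w, s} Input Pulse Output)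
    (A : RingAlgorithm.{u, v, w, s} Input Msg Output) (sim : B.State → A.State) {n : ℕ}
    (ids : ZMod n → ℕ) (inp : ZMod n → Input) : Prop :=
  ∀ schedB : Schedule n, B.Fair ids inp schedB →
    ∃ schedA : Schedule n, A.Fair ids inp schedA ∧
      (∀ (t : ℕ) (i : ZMod n),
        sim ((B.run ids inp schedB t).state i) = (A.run ids inp schedA t).state i) ∧
      (A.Terminates ids inp schedA → B.Terminates ids inp schedB) ∧
      (A.ReachesQuiescence ids inp schedA → B.ReachesQuiescence ids inp schedB)

end RingAlgorithm

/-! The simulation elects a leader and then keeps exactly one pulse in transit, so that the whole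
execution becomes sequential. Information is carried in unary by the number of counterclockwise
pulses that each node has received.

Election. A node with label `ids i + 1` emits that many clockwise pulses, absorbs equally many and
forwards the rest, so it has always sent `max cwCount label`. Once it has received `label` clockwise
pulses it plays the same game counterclockwise. The delayed start of the second game makes the end
detectable: a node whose two counts both equal its label must carry the largest label, and at that
moment nothing else is in transit and all counts agree (`election_sound`,
`Electing.deliver_leader`). The election cannot stall (`Electing.exists_chan_ne_nil`), and its
number of deliveries is bounded.

Token. From then on the common value of `ccwCount` encodes a snapshot of the simulated channels and
of which nodes have terminated. The owner of the token sends a counterclockwise pulse around the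
ring again and again until the counter encodes the snapshot it wants; as counters only grow, a
`Coding` must offer every snapshot beyond every bound. A clockwise pulse then hands the token over.
It cannot be mistaken for an election pulse, since now `ccwCount` exceeds `max cwCount label`, which
is impossible during the election.

In its first tour the token collects the initial acts of all nodes. Afterwards each owner simulates
one delivery to itself, at alternating ports, which makes the simulated schedule fair
(`fair_simSchedule`). An owner that sees no message in transit stays silent, or, if all simulated
nodes have terminated, dies and sends a last pulse around that makes the others die too
(`reaches_halted`).

The proof follows `Related`, an invariant with one case for each phase: `Electing`, `Pumping`,
`Passing`, `Dying`, `Halted`. Progress lemmas then show that fairness drives every execution through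
these phases. -/

instance : Fintype Port := ⟨{Port.ccw, Port.cw}, fun p => by cases p <;> simp⟩

@[simp] theorem Port.opp_opp (p : Port) : p.opp.opp = p := by cases p <;> rfl

@[simp] theorem neighbor_cw {n : ℕ} (i : ZMod n) : neighbor i Port.cw = i + 1 := rfl

@[simp] theorem neighbor_ccw {n : ℕ} (i : ZMod n) : neighbor i Port.ccw = i - 1 := rfl

@[simp] theorem neighbor_neighbor_opp {n : ℕ} (i : ZMod n) (p : Port) :
    neighbor (neighbor i p) p.opp = i := by
  cases p <;> simp [Port.opp, neighbor]

/-- A map from `ℕ` that takes every value of `T` arbitrarily late. -/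
structure Coding (T : Type*) where
  decode : ℕ → T
  code : ℕ → T → ℕ
  lt_code : ∀ c x, c < code c x
  decode_code : ∀ c x, decode (code c x) = x

/-- Run a surjection from `ℕ` on the first component of an unpaired number; the second component is
free and makes the code exceed any bound. -/
theorem Coding.nonempty (T : Type*) [Countable T] [Nonempty T] : Nonempty (Coding T) := by
  obtain ⟨f, hf⟩ := exists_surjective_nat T
  choose g hg using hf
  refine ⟨⟨fun k => f k.unpair.1, fun c x => Nat.pair (g x) (c + 1), fun c x => ?_, fun c x => ?_⟩⟩
  · exact Nat.lt_of_lt_of_le (Nat.lt_succ_self c) (Nat.right_le_pair _ _)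
  · simp [hg]

namespace RingAlgorithm

variable {Input : Type u} {Msg : Type v} {Output : Type w}

/-! ### Executions, quiescence and termination -/

section General

variable (A : RingAlgorithm.{u, v, w, s} Input Msg Output) {n : ℕ}

/-- One step of an execution, in which at most one message is delivered. -/
def next (c : A.Config n) : Option (ZMod n × Port) → A.Config n
  | none => c
  | some (i, p) => A.deliver c i p

theorem run_succ (ids : ZMod n → ℕ) (inp : ZMod n → Input) (sched : Schedule n) (t : ℕ) :
    A.run ids inp sched (t + 1) = A.next (A.run ids inp sched t) (sched t) := by
  rw [run]
  rcases sched t with _ | ⟨i, p⟩ <;> rfl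

theorem deliver_nil {c : A.Config n} {i : ZMod n} {p : Port} (h : c.chan i p = []) :
    A.deliver c i p = c := by
  unfold deliver; rw [h]

theorem deliver_cons {c : A.Config n} {i : ZMod n} {p : Port} {m : Msg} {l : List Msg}
    (h : c.chan i p = m :: l) :
    A.deliver c i p =
      { state := fun k => if k = neighbor i p then
          (A.step (c.state (neighbor i p)) p.opp m).1 else c.state k
        chan := fun k q => (if k = i ∧ q = p then l else c.chan k q) ++
          (if k = neighbor i p then (A.step (c.state (neighbor i p)) p.opp m).2 q else []) } := by
  unfold deliver; rw [h]

/-- No message is in transit. -/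
def Config.Quiescent {A : RingAlgorithm.{u, v, w, s} Input Msg Output} (c : A.Config n) : Prop :=
  ∀ i p, c.chan i p = []

theorem Config.Quiescent.next_eq {c : A.Config n} (h : c.Quiescent)
    (e : Option (ZMod n × Port)) : A.next c e = c := by
  rcases e with _ | ⟨i, p⟩
  · rfl
  · exact A.deliver_nil (h i p)

theorem run_eq_of_quiescent {ids : ZMod n → ℕ} {inp : ZMod n → Input} {sched : Schedule n} {t : ℕ}
    (h : (A.run ids inp sched t).Quiescent) {t' : ℕ} (ht : t ≤ t') :
    A.run ids inp sched t' = A.run ids inp sched t := by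
  induction t', ht using Nat.le_induction with
  | base => rfl
  | succ k _ ih => rw [run_succ, ih, h.next_eq]

theorem next_of_terminated {c : A.Config n} (h : ∀ i, A.Terminated (c.state i))
    (e : Option (ZMod n × Port)) :
    (A.next c e).state = c.state ∧ ∀ i p, (A.next c e).chan i p =
      if e = some (i, p) then (c.chan i p).tail else c.chan i p := by
  rcases e with _ | ⟨i, p⟩
  · simp [next]
  · simp only [next]
    rcases hc : c.chan i p with _ | ⟨m, l⟩
    · rw [A.deliver_nil hc]
      refine ⟨rfl, fun k q => ?_⟩
      split_ifs with hk
      · simp only [Option.some.injEq, Prod.mk.injEq] at hk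
        rw [← hk.1, ← hk.2, hc]; rfl
      · rfl
    · rw [A.deliver_cons hc, h]
      refine ⟨?_, fun k q => ?_⟩
      · funext k; simp only; split_ifs with hk
        · rw [hk]
        · rfl
      · simp only [Option.some.injEq, Prod.mk.injEq, ite_self, List.append_nil]
        by_cases hk : k = i ∧ q = p
        · rw [if_pos hk, if_pos ⟨hk.1.symm, hk.2.symm⟩, hk.1, hk.2, hc]; rfl
        · rw [if_neg hk, if_neg (fun h => hk ⟨h.1.symm, h.2.symm⟩)]

theorem run_state_of_terminated {ids : ZMod n → ℕ} {inp : ZMod n → Input} {sched : Schedule n}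
    {t : ℕ} (h : ∀ i, A.Terminated ((A.run ids inp sched t).state i)) {t' : ℕ} (ht : t ≤ t') :
    (A.run ids inp sched t').state = (A.run ids inp sched t).state := by
  induction t', ht using Nat.le_induction with
  | base => rfl
  | succ k _ ih =>
    rw [run_succ, (A.next_of_terminated (by rw [ih]; exact h) _).1, ih]

/-- Once all nodes have terminated nothing is sent, so channel lengths never grow and each fair
delivery shortens a nonempty channel. There are finitely many channels, hence a common time at which
all are empty. -/
theorem Terminates.reachesQuiescence [NeZero n] {ids : ZMod n → ℕ} {inp : ZMod n → Input}
    {sched : Schedule n} (hf : A.Fair ids inp sched) (h : A.Terminates ids inp sched) :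
    A.ReachesQuiescence ids inp sched := by
  obtain ⟨t₀, h⟩ := h
  have step : ∀ t, t₀ ≤ t → ∀ i p, (A.run ids inp sched (t + 1)).chan i p =
      if sched t = some (i, p) then ((A.run ids inp sched t).chan i p).tail
      else (A.run ids inp sched t).chan i p := fun t ht i p => by
    rw [run_succ, (A.next_of_terminated (by rw [A.run_state_of_terminated h ht]; exact h) _).2]
  have anti : ∀ i p t, t₀ ≤ t → ∀ t', t ≤ t' → ((A.run ids inp sched t').chan i p).length ≤
      ((A.run ids inp sched t).chan i p).length := fun i p t ht t' ht' => by
    induction t', ht' using Nat.le_induction with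
    | base => exact le_rfl
    | succ k hk ih =>
      rw [step k (ht.trans hk)]
      split_ifs
      · rw [List.length_tail]; omega
      · exact ih
  have key : ∀ i p l t, t₀ ≤ t → ((A.run ids inp sched t).chan i p).length ≤ l →
      ∃ t', t₀ ≤ t' ∧ (A.run ids inp sched t').chan i p = [] := by
    intro i p l
    induction l with
    | zero => exact fun t ht hl => ⟨t, ht, List.eq_nil_of_length_eq_zero (Nat.le_zero.mp hl)⟩
    | succ l ih =>
      intro t ht hl
      by_cases h0 : (A.run ids inp sched t).chan i p = []
      · exact ⟨t, ht, h0⟩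
      · obtain ⟨t', ht', hs⟩ := hf t i p h0
        refine ih (t' + 1) (by omega) ?_
        rw [step t' (ht.trans ht'), if_pos hs, List.length_tail]
        have := anti i p t ht t' ht'
        omega
  have ev : ∀ᶠ t in Filter.atTop, ∀ i p, (A.run ids inp sched t).chan i p = [] := by
    refine Filter.eventually_all.mpr fun i => Filter.eventually_all.mpr fun p => ?_
    obtain ⟨t', ht', h'⟩ := key i p _ t₀ le_rfl le_rfl
    filter_upwards [Filter.eventually_ge_atTop t'] with t ht
    have := anti i p t' ht' t ht
    rw [h'] at this
    exact List.eq_nil_of_length_eq_zero (Nat.le_zero.mp this)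
  exact ev.exists

/-- Only a delivery on a channel removes a message from it. -/
theorem chan_next_ne_nil {c : A.Config n} {i : ZMod n} {p : Port} (h : c.chan i p ≠ [])
    {e : Option (ZMod n × Port)} (he : e ≠ some (i, p)) : (A.next c e).chan i p ≠ [] := by
  rcases e with _ | ⟨j, q⟩
  · exact h
  · simp only [next]
    rcases hc : c.chan j q with _ | ⟨m, l⟩
    · rwa [A.deliver_nil hc]
    · rw [A.deliver_cons hc]
      have : ¬ (i = j ∧ p = q) := fun hh => he (by rw [hh.1, hh.2])
      simp [this, h]

end General

/-! ### The content-oblivious algorithm -/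

section Construction

variable (A : RingAlgorithm.{u, v, w, s} Input Msg Output)

/-- What the token says about one node: the messages in transit that the node has sent through
its ports, and whether the node has terminated. -/
abbrev Entry (Msg : Type v) : Type v := (Port → List Msg) × Prop

/-- The distance from a node to its neighbour through a port, clockwise. -/
def offset (n : ℕ) : Port → ℕ
  | Port.ccw => n - 1
  | Port.cw => 1 % n

/-- The effect that the delivery of a message at port `p` of a node in state `x` has on this state
and on the token, a list of entries that starts with this node and goes clockwise. -/
def advance (x : A.State) (p : Port) (L : List (Entry Msg)) : A.State × List (Entry Msg) :=
  match L[offset L.length p]?.elim [] (fun e => e.1 p.opp) with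
  | [] => (x, L)
  | m :: l =>
    ((A.step x p m).1, L.mapIdx fun k e =>
      (fun q => (if k = offset L.length p ∧ q = p.opp then l else e.1 q) ++
        (if k = 0 then (A.step x p m).2 q else []),
       if k = 0 then A.Terminated (A.step x p m).1 else e.2))

/-- The local states of the content-oblivious simulation. The counters `cwCount` and `ccwCount`
count the pulses received that travel clockwise and counterclockwise. -/
structure NodeState (S : Type s) : Type s where
  sim : S
  label : ℕ
  cwCount : ℕ
  ccwCount : ℕ
  goal : ℕ
  pend : ℕ
  turn : Port
  joined : Prop
  dead : Prop

/-- One pulse through the given port. -/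
def single (p : Port) : Port → List Pulse := fun q => if q = p then [()] else []

/-- No pulses. -/
def silent : Port → List Pulse := fun _ => []

/-- The first part of a token is the list of all messages in transit. -/
def AllDelivered (L : List (Entry Msg)) : Prop := ∀ e ∈ L, ∀ p, e.1 p = []

open Classical in
/-- What a node does when it obtains the token `L`. -/
noncomputable def act (C : Coding (List (Entry Msg))) (x : NodeState A.State)
    (L : List (Entry Msg)) : NodeState A.State × (Port → List Pulse) :=
  if x.joined then
    if AllDelivered L then
      if ∀ e ∈ L, e.2 then ({ x with dead := True }, single Port.cw) else (x, silent)
    else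
      ({ x with
          sim := (A.advance x.sim x.turn L).1
          turn := x.turn.opp
          goal := C.code x.ccwCount ((A.advance x.sim x.turn L).2.rotate 1) }, single Port.ccw)
  else
    ({ x with
        joined := True
        goal := C.code x.ccwCount (L ++ C.decode x.pend) }, single Port.ccw)

open Classical in
/-- The reaction to a pulse that travels counterclockwise. -/
noncomputable def onCcw (C : Coding (List (Entry Msg))) (x : NodeState A.State) :
    NodeState A.State × (Port → List Pulse) :=
  if x.dead then (x, silent)
  else if x.ccwCount + 1 = x.goal then
    ({ x with ccwCount := x.ccwCount + 1 }, single Port.cw)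
  else if x.cwCount < x.label then ({ x with ccwCount := x.ccwCount + 1 }, silent)
  else if x.cwCount = x.label ∧ x.ccwCount + 1 = x.label then
    A.act C { x with ccwCount := x.ccwCount + 1 } []
  else
    ({ x with ccwCount := x.ccwCount + 1 },
      if x.label < x.ccwCount + 1 then single Port.ccw else silent)

open Classical in
/-- The reaction to a pulse that travels clockwise. -/
noncomputable def onCw (C : Coding (List (Entry Msg))) (x : NodeState A.State) :
    NodeState A.State × (Port → List Pulse) :=
  if x.dead then (x, silent)
  else if max x.cwCount x.label < x.ccwCount then A.act C x (C.decode x.ccwCount)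
  else
    ({ x with cwCount := x.cwCount + 1 }, fun p => match p with
      | Port.cw => if x.label < x.cwCount + 1 then [()] else []
      | Port.ccw =>
        if x.cwCount + 1 = x.label then List.replicate (max x.ccwCount x.label) () else [])

/-- The content-oblivious simulation of `A`. First the node with the largest label is elected; from
then on one pulse is in transit. The number of counterclockwise pulses, the same at all nodes,
encodes the token. The owner of the token sends pulses around the ring until this number encodes
the token as the owner has updated it, and then hands it over to the clockwise neighbour. -/
noncomputable def oblivious (C : Coding (List (Entry Msg))) :
    RingAlgorithm.{u, 0, w, s} Input Pulse Output where
  State := NodeState A.State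
  init k a :=
    ({ sim := (A.init k a).1
       label := k + 1
       cwCount := 0
       ccwCount := 0
       goal := 0
       pend := C.code 0 [((A.init k a).2, A.Terminated (A.init k a).1)]
       turn := Port.cw
       joined := False
       dead := False },
     fun p => match p with
      | Port.cw => List.replicate (k + 1) ()
      | Port.ccw => [])
  step x p _ := match p with
    | Port.cw => A.onCcw C x
    | Port.ccw => A.onCw C x
  output x := A.output x.sim

open Classical in
/-- The delivery of the execution of `A` that corresponds to a delivery of the simulation. -/
noncomputable def simEvent (C : Coding (List (Entry Msg))) {n : ℕ}
    (b : (A.oblivious C).Config n) : Option (ZMod n × Port) → Option (ZMod n × Port)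
  | some (i, Port.cw) =>
    let x : NodeState A.State := b.state (i + 1)
    if b.chan i Port.cw ≠ [] ∧ x.joined ∧ ¬ x.dead ∧ ¬ AllDelivered (C.decode x.ccwCount) then
      some (neighbor (i + 1) x.turn, x.turn.opp) else none
  | _ => none

end Construction

end RingAlgorithm

namespace RingAlgorithm

variable {Input : Type u} {Msg : Type v} {Output : Type w}

/-! ### Arithmetic of the ring and soundness of the election -/

section Ring

variable {n : ℕ} [NeZero n]

omit [NeZero n] in
theorem zmod_natCast_inj {k l : ℕ} (hk : k < n) (hl : l < n) : (k : ZMod n) = l ↔ k = l :=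
  ⟨fun h => by
    have := congrArg ZMod.val h
    rwa [ZMod.val_natCast_of_lt hk, ZMod.val_natCast_of_lt hl] at this, fun h => by rw [h]⟩

/-- The remainder in `offset` covers `n = 1`, where the clockwise neighbour is the node itself. -/
theorem offset_lt (p : Port) : offset n p < n := by
  cases p
  · exact Nat.sub_lt (NeZero.pos n) one_pos
  · exact Nat.mod_lt _ (NeZero.pos n)

theorem neighbor_eq_add_offset (i : ZMod n) (p : Port) : neighbor i p = i + (offset n p : ℕ) := by
  cases p
  · simp [neighbor, offset, Nat.cast_sub (NeZero.one_le (n := n)), sub_eq_add_neg]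
  · simp [neighbor, offset]

theorem val_add_one (z : ZMod n) : (z + 1).val = if z + 1 = 0 then 0 else z.val + 1 := by
  split_ifs with h
  · rw [h, ZMod.val_zero]
  · have hz : ((z.val + 1 : ℕ) : ZMod n) = z + 1 := by simp
    have hlt : z.val + 1 < n := by
      refine lt_of_le_of_ne (ZMod.val_lt z) fun hn => h ?_
      rw [← hz, hn, ZMod.natCast_self]
    rw [← hz, ZMod.val_natCast_of_lt hlt]

/-- Induction around the ring. -/
theorem forall_of_forall_add {P : ZMod n → Prop} (j : ZMod n) (h : ∀ k < n, P (j + (k : ℕ)))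
    (i : ZMod n) : P i := by
  have := h (i - j).val (ZMod.val_lt _)
  simpa using this

/-- A function that does not decrease from node to node is constant on a ring. -/
theorem eq_of_le_add_one {f : ZMod n → ℕ} (h : ∀ i, f i ≤ f (i + 1)) (i j : ZMod n) :
    f i = f j := by
  have mono : ∀ (k : ℕ) (i : ZMod n), f i ≤ f (i + k) := fun k => by
    induction k with
    | zero => simp
    | succ k ih => intro i; rw [Nat.cast_succ, ← add_assoc]; exact (ih i).trans (h _)
  have le : ∀ i j : ZMod n, f i ≤ f j := fun i j => by
    simpa using mono (j - i).val i
  exact le_antisymm (le i j) (le j i)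

/-- In the election, a node that has received as many pulses as its label in both directions
has the largest label, and the election is over. -/
theorem election_sound {r q l : ZMod n → ℕ} (hl : Function.Injective l)
    (hr : ∀ i, r (i + 1) ≤ max (r i) (l i)) (hq : ∀ i, q i ≤ max (r i) (l i))
    (hqs : ∀ i, q i ≤ if r (i + 1) < l (i + 1) then 0 else max (q (i + 1)) (l (i + 1)))
    {j : ZMod n} (hj : r j ≤ l j) (hpos : 0 < l j)
    (hj' : l j ≤ if r (j + 1) < l (j + 1) then 0 else max (q (j + 1)) (l (j + 1))) :
    (∀ i, i ≠ j → l i < l j ∧ r i = l j ∧ q i = l j) ∧ r j = l j := by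
  -- Induction clockwise from `j`. At the next node `x` the lower bound `l j > 0` excludes `r x < l
  -- x`, so `l x ≤ r x ≤ l j`, strictly for `l x` by injectivity. Hence `max (q x) (l x) ≥ l j` is
  -- attained by `q x`, and `q x ≤ r x ≤ l j` gives equality; `hqs` carries the lower bound on to `x
  -- + 1`.
  have key : ∀ k < n, (k ≠ 0 → l (j + k) < l j ∧ r (j + k) = l j ∧ q (j + k) = l j) ∧
      r (j + k + 1) ≤ l j ∧
      l j ≤ if r (j + k + 1) < l (j + k + 1) then 0 else max (q (j + k + 1)) (l (j + k + 1)) := by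
    intro k
    induction k with
    | zero =>
      intro _
      have := hr j
      rw [max_eq_right hj] at this
      simpa using ⟨this, hj'⟩
    | succ k ih =>
      intro hk
      obtain ⟨-, h1, h2⟩ := ih (by omega)
      have hne : j + (k : ZMod n) + 1 ≠ j := by
        rw [add_assoc, Ne, add_eq_left]
        have := (zmod_natCast_inj (n := n) hk (NeZero.pos n)).not.mpr (Nat.succ_ne_zero k)
        simpa using this
      rw [Nat.cast_succ, ← add_assoc]
      generalize j + (k : ZMod n) + 1 = x at *
      have hlx := hl.ne hne
      have a1 := hq x
      have a2 := hr x
      have a3 := hqs x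
      have hx : ¬ r x < l x := by
        intro hx; rw [if_pos hx] at h2; omega
      rw [if_neg hx] at h2
      have hlx' : l x < l j := by omega
      have hqx : q x = l j := by omega
      refine ⟨fun _ => ⟨hlx', by omega, hqx⟩, by omega, hqx ▸ a3⟩
  refine ⟨fun i => forall_of_forall_add (P := fun i => i ≠ j → l i < l j ∧ r i = l j ∧ q i = l j) j
    (fun k hk hne => ?_) i, ?_⟩
  · exact (key k hk).1 (by rintro rfl; simp at hne)
  -- After a full turn the lower bound has come back to `j` itself and rules out `r j < l j`.
  · have h2 := (key (n - 1) (Nat.sub_lt (NeZero.pos n) one_pos)).2.2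
    have e : j + ((n - 1 : ℕ) : ZMod n) + 1 = j := by
      simp [Nat.cast_sub (NeZero.one_le (n := n))]
    rw [e] at h2
    split_ifs at h2 <;> omega

end Ring

/-! ### The token as a snapshot of a configuration -/

section Token

variable (A : RingAlgorithm.{u, v, w, s} Input Msg Output) {n : ℕ}

/-- The entry of a token that describes node `i`. -/
def entry {A : RingAlgorithm.{u, v, w, s} Input Msg Output} (c : A.Config n) (i : ZMod n) :
    Entry Msg :=
  (c.chan i, A.Terminated (c.state i))

/-- The token that describes the nodes `j`, ..., `j + m - 1`. -/
def view {A : RingAlgorithm.{u, v, w, s} Input Msg Output} (c : A.Config n) (j : ZMod n) (m : ℕ) :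
    List (Entry Msg) :=
  (List.range m).map fun k => entry c (j + (k : ℕ))

theorem length_view (c : A.Config n) (j : ZMod n) (m : ℕ) : (view c j m).length = m := by
  simp [view]

theorem view_succ (c : A.Config n) (j : ZMod n) (m : ℕ) :
    view c j (m + 1) = view c j m ++ [entry c (j + m)] := by
  simp [view, List.range_succ]

theorem forall_mem_view [NeZero n] (c : A.Config n) (j : ZMod n) (P : Entry Msg → Prop) :
    (∀ e ∈ view c j n, P e) ↔ ∀ i, P (entry c i) := by
  simp only [view, List.mem_map, List.mem_range, forall_exists_index, and_imp,
    forall_apply_eq_imp_iff₂]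
  exact ⟨fun h i => forall_of_forall_add (P := fun i => P (entry c i)) j h i, fun h k _ => h _⟩

theorem allDelivered_view [NeZero n] (c : A.Config n) (j : ZMod n) :
    AllDelivered (view c j n) ↔ c.Quiescent :=
  A.forall_mem_view c j _

theorem rotate_view [NeZero n] (c : A.Config n) (j : ZMod n) :
    (view c j n).rotate 1 = view c (j + 1) n := by
  refine List.ext_getElem (by simp [length_view]) fun k h1 h2 => ?_
  rw [List.getElem_rotate]
  simp [view, add_assoc, add_comm (1 : ZMod n)]

/-- The snapshot, together with its own state, is all a node needs to carry out a delivery to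
itself: only the channel it reads, its own channels and its own termination flag change. -/
theorem advance_view [NeZero n] (c : A.Config n) (j : ZMod n) (p : Port) :
    A.advance (c.state j) p (view c j n) =
      ((A.deliver c (neighbor j p) p.opp).state j,
        view (A.deliver c (neighbor j p) p.opp) j n) := by
  have hget : (view c j n)[offset n p]?.elim [] (fun e => e.1 p.opp) =
      c.chan (neighbor j p) p.opp := by
    rw [neighbor_eq_add_offset, List.getElem?_eq_getElem (by simpa [length_view] using offset_lt p)]
    simp [view, entry]
  unfold advance
  rw [length_view, hget]
  rcases hc : c.chan (neighbor j p) p.opp with _ | ⟨m, l⟩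
  · rw [A.deliver_nil hc]
  · rw [A.deliver_cons hc]
    simp only [neighbor_neighbor_opp, Port.opp_opp, if_true]
    congr 1
    refine List.ext_getElem (by simp [length_view]) fun k h1 h2 => ?_
    have hk : k < n := by simpa [length_view] using h2
    have e1 : j + (k : ZMod n) = neighbor j p ↔ k = offset n p := by
      rw [neighbor_eq_add_offset, add_right_inj, zmod_natCast_inj hk (offset_lt p)]
    have e2 : j + (k : ZMod n) = j ↔ k = 0 := by
      have := zmod_natCast_inj hk (NeZero.pos n)
      rw [add_eq_left, ← this, Nat.cast_zero]
    simp only [List.getElem_mapIdx, view, List.getElem_map, List.getElem_range, entry, e1, e2]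
    congr 1
    by_cases h0 : k = 0 <;> simp [h0]

end Token

/-! ### Configurations with a single pulse in transit -/

section Pulse

variable (B : RingAlgorithm.{u, 0, w, s} Input Pulse Output) {n : ℕ}

/-- The channels when a single pulse is in transit. -/
def pulse (i : ZMod n) (p : Port) : ZMod n → Port → List Pulse :=
  fun k q => if k = i ∧ q = p then [()] else []

theorem pulse_self (i : ZMod n) (p : Port) : pulse i p i p = [()] := by simp [pulse]

/-- Delivery of the only pulse in transit. -/
theorem deliver_pulse {c : B.Config n} {i : ZMod n} {p : Port} (h : c.chan = pulse i p) :
    (B.deliver c i p).state = (fun k => if k = neighbor i p then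
        (B.step (c.state (neighbor i p)) p.opp ()).1 else c.state k) ∧
    (∀ q, (B.step (c.state (neighbor i p)) p.opp ()).2 = single q →
      (B.deliver c i p).chan = pulse (neighbor i p) q) ∧
    ((B.step (c.state (neighbor i p)) p.opp ()).2 = silent → (B.deliver c i p).Quiescent) := by
  have hc : c.chan i p = [()] := by rw [h, pulse_self]
  rw [B.deliver_cons hc]
  refine ⟨rfl, fun q hq => ?_, fun hq k q' => ?_⟩
  · funext k q'
    have : (if k = i ∧ q' = p then [] else if k = i ∧ q' = p then [()] else []) =
        ([] : List Pulse) := by split_ifs <;> rfl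
    simp only [hq, h, pulse, single, this, List.nil_append]
    simp only [ite_and]
  · simp only [hq, h, pulse, silent]
    by_cases h3 : k = i ∧ q' = p
    all_goals simp [h3]

end Pulse

end RingAlgorithm

namespace RingAlgorithm

variable {Input : Type u} {Msg : Type v} {Output : Type w}

/-! ### Invariants and progress of the election -/

section Election

variable {A : RingAlgorithm.{u, v, w, s} Input Msg Output} {C : Coding (List (Entry Msg))} {n : ℕ}

/-- The local state of a node, with its components. -/
abbrev node (b : (A.oblivious C).Config n) (i : ZMod n) : NodeState A.State := b.state i

/-- The number of counterclockwise pulses a node has sent during the election. -/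
def NodeState.ccwSent {S : Type s} (x : NodeState S) : ℕ :=
  if x.cwCount < x.label then 0 else max x.ccwCount x.label

variable (ids : ZMod n → ℕ) (inp : ZMod n → Input)

/-- The part of a local state that does not change during the election. -/
structure Fresh (C : Coding (List (Entry Msg))) (i : ZMod n) (x : NodeState A.State) : Prop where
  pend : C.decode x.pend = [entry (A.initConfig ids inp) i]
  sim : x.sim = (A.initConfig ids inp).state i
  label : x.label = ids i + 1
  goal : x.goal = 0
  joined : ¬ x.joined
  dead : ¬ x.dead

/-- The configurations in which the election is not over. -/
structure Electing (b : (A.oblivious C).Config n) : Prop where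
  fresh : ∀ i, Fresh ids inp C i (node b i)
  cw : ∀ i, (b.chan i Port.cw).length + (node b (i + 1)).cwCount =
    max (node b i).cwCount (node b i).label
  ccw : ∀ i, (b.chan i Port.ccw).length + (node b (i - 1)).ccwCount = (node b i).ccwSent
  ccw_le : ∀ i, (node b i).ccwCount ≤ max (node b i).cwCount (node b i).label
  cw_le : ∀ M, (∀ i, (node b i).label ≤ M) → ∀ i, (node b i).cwCount ≤ M
  undecided : ∀ i, (node b i).cwCount = (node b i).label →
    (node b i).ccwCount ≠ (node b i).label

theorem electing_init : Electing ids inp ((A.oblivious C).initConfig ids inp) where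
  fresh i := ⟨C.decode_code _ _, rfl, rfl, rfl, id, id⟩
  cw i := by simp [initConfig, oblivious]
  ccw i := by simp [initConfig, oblivious, NodeState.ccwSent]
  ccw_le i := Nat.zero_le _
  cw_le M _ i := Nat.zero_le _
  -- Labels are positive, so a count of `0` never equals the label; this is why the label is the
  -- identifier plus one.
  undecided i h := by simp [node, initConfig, oblivious] at h

/-- The number of pulses received. -/
def totalCount [NeZero n] (b : (A.oblivious C).Config n) : ℕ :=
  ∑ i, ((node b i).cwCount + (node b i).ccwCount)

theorem totalCount_lt [NeZero n] {b b' : (A.oblivious C).Config n} {j : ZMod n}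
    (hne : ∀ k, k ≠ j → b'.state k = b.state k)
    (hj : (node b' j).cwCount + (node b' j).ccwCount =
      (node b j).cwCount + (node b j).ccwCount + 1) :
    totalCount b < totalCount b' := by
  refine Finset.sum_lt_sum (fun k _ => ?_) ⟨j, Finset.mem_univ _, by omega⟩
  by_cases hk : k = j
  · subst hk; omega
  · rw [node, node, hne k hk]

variable {ids inp}

theorem Electing.label_injective {b : (A.oblivious C).Config n} (h : Electing ids inp b)
    (hids : Function.Injective ids) : Function.Injective fun i => (node b i).label :=
  fun i k hik => hids <| by
    have : (node b i).label = (node b k).label := hik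
    rw [(h.fresh i).label, (h.fresh k).label] at this
    omega

theorem Electing.cw_succ_le {b : (A.oblivious C).Config n} (h : Electing ids inp b) (i : ZMod n) :
    (node b (i + 1)).cwCount ≤ max (node b i).cwCount (node b i).label :=
  (Nat.le_add_left _ _).trans (h.cw i).le

theorem Electing.ccw_le_sent {b : (A.oblivious C).Config n} (h : Electing ids inp b)
    (i : ZMod n) : (node b i).ccwCount ≤ (node b (i + 1)).ccwSent := by
  have := h.ccw (i + 1)
  rw [add_sub_cancel_right] at this
  omega

theorem Electing.sound [NeZero n] {b : (A.oblivious C).Config n} (h : Electing ids inp b)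
    (hids : Function.Injective ids) {j : ZMod n} (hj : (node b j).cwCount ≤ (node b j).label)
    (hj' : (node b j).label ≤ (node b (j + 1)).ccwSent) :
    (∀ i, i ≠ j → (node b i).label < (node b j).label ∧
      (node b i).cwCount = (node b j).label ∧ (node b i).ccwCount = (node b j).label) ∧
      (node b j).cwCount = (node b j).label :=
  election_sound (h.label_injective hids) h.cw_succ_le h.ccw_le h.ccw_le_sent hj
    (by rw [(h.fresh _).label]; omega) hj'

/-- With empty channels, everything sent has been received. Then `cwCount` is weakly increasing
around the ring, hence constant, and equals the largest label. So every node has started the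
counterclockwise game, in which the largest label propagates all the way back to its owner `j`; both
counts of `j` then equal its label, against `undecided`. -/
theorem Electing.exists_chan_ne_nil [NeZero n] {b : (A.oblivious C).Config n}
    (h : Electing ids inp b) : ∃ i p, b.chan i p ≠ [] := by
  by_contra! hc
  obtain ⟨j, hj⟩ := Finite.exists_max fun i => (node b i).label
  have hr : ∀ i, (node b (i + 1)).cwCount = max (node b i).cwCount (node b i).label := fun i => by
    simpa [hc] using h.cw i
  have hr' := eq_of_le_add_one (f := fun i => (node b i).cwCount) fun i => by
    rw [hr]; exact le_max_left _ _
  have hrj := h.cw_le _ hj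
  have hlr : ∀ i, (node b i).label ≤ (node b i).cwCount := fun i => by
    have := hr i; have := hr' (i + 1) i; omega
  have hq : ∀ i, (node b (i - 1)).ccwCount = max (node b i).ccwCount (node b i).label := fun i => by
    have := h.ccw i
    rw [hc, NodeState.ccwSent, if_neg (hlr i).not_gt] at this
    simpa using this
  have hrj' := hrj j
  have hlrj := hlr j
  refine h.undecided j (by omega) ?_
  have e := hq j
  have hM : ∀ i, (node b i).ccwCount ≤ (node b j).label := fun i => by
    have := h.ccw_le i; have := hj i; have := hrj i; omega
  have mono : ∀ (k : ℕ), (node b j).label ≤ (node b (j - 1 - k)).ccwCount := fun k => by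
    induction k with
    | zero => simp [e]
    | succ k ih =>
      have := hq (j - 1 - k)
      rw [Nat.cast_succ, ← sub_sub, this]
      exact ih.trans (le_max_left _ _)
  -- The node `j - 1 - (n - 1)` is `j` again.
  have := mono (n - 1)
  rw [Nat.cast_sub (NeZero.one_le (n := n)), ZMod.natCast_self] at this
  simp only [Nat.cast_one, zero_sub, sub_neg_eq_add, sub_add_cancel] at this
  exact le_antisymm (hM j) this

theorem Electing.totalCount_le [NeZero n] {b : (A.oblivious C).Config n}
    (h : Electing ids inp b) {M : ℕ} (hM : ∀ i, ids i + 1 ≤ M) : totalCount b ≤ n * (2 * M) := by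
  have hM' : ∀ i, (node b i).label ≤ M := fun i => by rw [(h.fresh _).label]; exact hM i
  have : totalCount b ≤ ∑ _i : ZMod n, 2 * M := Finset.sum_le_sum fun i _ => by
    have := h.cw_le M hM' i; have := h.ccw_le i; have := hM' i; omega
  simpa [ZMod.card] using this

/-- A step of the election in which node `neighbor i p` receives a pulse. -/
theorem Electing.deliver {b : (A.oblivious C).Config n} (h : Electing ids inp b)
    {i : ZMod n} {p : Port} (hi : b.chan i p ≠ []) {x y : NodeState A.State}
    {out : Port → List Pulse} (hy : node b (neighbor i p) = y)
    (hstep : (A.oblivious C).step (b.state (neighbor i p)) p.opp () = (x, out))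
    (hx : Fresh ids inp C (neighbor i p) x)
    (hxcw : x.cwCount = y.cwCount + if p = Port.cw then 1 else 0)
    (hxccw : x.ccwCount = y.ccwCount + if p = Port.ccw then 1 else 0)
    (hcw : (out Port.cw).length + max y.cwCount y.label = max x.cwCount x.label)
    (hccw : (out Port.ccw).length + y.ccwSent = x.ccwSent)
    (hle : x.ccwCount ≤ max x.cwCount x.label)
    (hM : ∀ M, (∀ i, (node b i).label ≤ M) → x.cwCount ≤ M)
    (hun : x.cwCount = x.label → x.ccwCount ≠ x.label) :
    Electing ids inp ((A.oblivious C).deliver b i p) := by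
  obtain ⟨m, l, hc⟩ := List.exists_cons_of_ne_nil hi
  rw [(A.oblivious C).deliver_cons hc]
  generalize hj : neighbor i p = j at *
  have hstep' : (A.oblivious C).step (b.state j) p.opp m = (x, out) := hstep
  rw [hstep']
  set b' : (A.oblivious C).Config n := _
  change Electing ids inp b'
  have hst : ∀ k, node b' k = if k = j then x else node b k := fun k => rfl
  have hlen : ∀ k q, (b'.chan k q).length + (if k = i ∧ q = p then 1 else 0) =
      (b.chan k q).length + if k = j then (out q).length else 0 := fun k q => by
    have : (b'.chan k q) = (if k = i ∧ q = p then l else b.chan k q) ++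
      (if k = j then out q else []) := rfl
    rw [this, List.length_append]
    have e : (if k = i ∧ q = p then l else b.chan k q).length + (if k = i ∧ q = p then 1 else 0) =
        (b.chan k q).length := by
      split_ifs with h1
      · rw [h1.1, h1.2, hc]; rfl
      · rfl
    have e' : (if k = j then out q else []).length = if k = j then (out q).length else 0 := by
      split_ifs <;> rfl
    omega
  have hcw' : ∀ k, (node b' k).cwCount =
      (node b k).cwCount + if k = j ∧ p = Port.cw then 1 else 0 := fun k => by
    rw [hst]
    by_cases hk : k = j
    · rw [if_pos hk, hxcw, hk, hy]; simp
    · simp [hk]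
  have hccw' : ∀ k, (node b' k).ccwCount =
      (node b k).ccwCount + if k = j ∧ p = Port.ccw then 1 else 0 := fun k => by
    rw [hst]
    by_cases hk : k = j
    · rw [if_pos hk, hxccw, hk, hy]; simp
    · simp [hk]
  have hlab : ∀ k, (node b k).label = (node b' k).label := fun k => by
    rw [hst]
    split_ifs with hk
    · rw [hk, hx.label]; exact (h.fresh j).label
    · rfl
  have hall : ∀ {P : ZMod n → NodeState A.State → Prop}, P j x → (∀ i, P i (node b i)) →
      ∀ i, P i (node b' i) := fun {P} h1 h2 i => by
    rw [hst]
    split_ifs with hk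
    · rw [hk]; exact h1
    · exact h2 i
  refine ⟨hall hx h.fresh, fun k => ?_, fun k => ?_,
    hall (P := fun _ x => x.ccwCount ≤ max x.cwCount x.label) hle h.ccw_le, fun M hl => ?_,
    hall (P := fun _ x => x.cwCount = x.label → x.ccwCount ≠ x.label) hun h.undecided⟩
  · have h1 := hlen k Port.cw
    have h2 := h.cw k
    have e : (k + 1 = j ∧ p = Port.cw) ↔ (k = i ∧ Port.cw = p) := by
      constructor
      · rintro ⟨hk, rfl⟩; rw [← hj] at hk; exact ⟨by simpa using hk, rfl⟩
      · rintro ⟨rfl, rfl⟩; exact ⟨hj, rfl⟩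
    have h3 := hcw' (k + 1)
    simp only [e] at h3
    have h4 : max (node b' k).cwCount (node b' k).label = max (node b k).cwCount (node b k).label +
        if k = j then (out Port.cw).length else 0 := by
      rw [hst]; split_ifs with hk
      · rw [hk, hy]; omega
      · rfl
    omega
  · have h1 := hlen k Port.ccw
    have h2 := h.ccw k
    have e : (k - 1 = j ∧ p = Port.ccw) ↔ (k = i ∧ Port.ccw = p) := by
      constructor
      · rintro ⟨hk, rfl⟩; rw [← hj] at hk; exact ⟨by simpa using hk, rfl⟩
      · rintro ⟨rfl, rfl⟩; exact ⟨hj, rfl⟩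
    have h3 := hccw' (k - 1)
    simp only [e] at h3
    have h4 : (node b' k).ccwSent = (node b k).ccwSent +
        if k = j then (out Port.ccw).length else 0 := by
      rw [hst]; split_ifs with hk
      · rw [hk, hy]; omega
      · rfl
    omega
  · exact hall (P := fun _ x => x.cwCount ≤ M) (hM M fun i => (hlab i).trans_le (hl i))
      (h.cw_le M fun i => (hlab i).trans_le (hl i))

theorem totalCount_lt_deliver [NeZero n] {b : (A.oblivious C).Config n} {i : ZMod n} {p : Port}
    (hi : b.chan i p ≠ []) {x : NodeState A.State} {out : Port → List Pulse}
    (hstep : (A.oblivious C).step (b.state (neighbor i p)) p.opp () = (x, out))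
    (hx : x.cwCount + x.ccwCount = (node b (neighbor i p)).cwCount +
      (node b (neighbor i p)).ccwCount + 1) :
    totalCount b < totalCount ((A.oblivious C).deliver b i p) := by
  obtain ⟨m, l, hc⟩ := List.exists_cons_of_ne_nil hi
  have hstep' : (A.oblivious C).step (b.state (neighbor i p)) p.opp m = (x, out) := hstep
  rw [(A.oblivious C).deliver_cons hc, hstep']
  refine totalCount_lt (j := neighbor i p) (fun k hk => by simp [hk]) ?_
  simpa [node] using hx

theorem Electing.deliver_cw [NeZero n] {b : (A.oblivious C).Config n} (h : Electing ids inp b)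
    (hids : Function.Injective ids) {i : ZMod n} (hi : b.chan i Port.cw ≠ []) :
    Electing ids inp ((A.oblivious C).deliver b i Port.cw) ∧
      totalCount b < totalCount ((A.oblivious C).deliver b i Port.cw) := by
  have hstep : (A.oblivious C).step (b.state (neighbor i Port.cw)) Port.cw.opp () =
      A.onCw C (node b (i + 1)) := rfl
  have hq := h.ccw_le (i + 1)
  have hfr := h.fresh (i + 1)
  have hcw := h.cw_succ_le i
  -- By `ccw_le` the test for a handed-over token fails during the election.
  rw [onCw, if_neg hfr.dead, if_neg hq.not_gt] at hstep
  refine ⟨h.deliver hi rfl hstep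
    ⟨hfr.pend, hfr.sim, hfr.label, hfr.goal, hfr.joined, hfr.dead⟩ ?_ ?_ ?_ ?_ ?_
    (fun M hM => ?_) (fun he hle => ?_), totalCount_lt_deliver hi hstep ?_⟩
  · simp
  · simp
  · simp only [neighbor_cw]; split_ifs <;> simp <;> omega
  · change (if (node b (i + 1)).cwCount + 1 = (node b (i + 1)).label then
        List.replicate (max (node b (i + 1)).ccwCount (node b (i + 1)).label) () else []).length +
      (if (node b (i + 1)).cwCount < (node b (i + 1)).label then 0
        else max (node b (i + 1)).ccwCount (node b (i + 1)).label) =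
      if (node b (i + 1)).cwCount + 1 < (node b (i + 1)).label then 0
        else max (node b (i + 1)).ccwCount (node b (i + 1)).label
    split_ifs <;> simp <;> omega
  · simp only; omega
  · have h1 := h.cw i
    have h2 := h.cw_le M hM i
    have h3 := hM i
    have h4 := List.length_pos_of_ne_nil hi
    simp only; omega
  -- A clockwise pulse never completes the election: if `ccwCount` already equals the label,
  -- soundness applied before the delivery says that `cwCount` has already reached the label too.
  · simp only at he hle
    have hs := h.ccw_le_sent (i + 1)
    have := (h.sound hids (j := i + 1) (by omega) (by omega)).2
    omega
  · simp only [neighbor_cw]; omega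

theorem Electing.deliver_ccw [NeZero n] {b : (A.oblivious C).Config n} (h : Electing ids inp b)
    {i : ZMod n} (hi : b.chan i Port.ccw ≠ [])
    (hun : ¬ ((node b (i - 1)).cwCount = (node b (i - 1)).label ∧
      (node b (i - 1)).ccwCount + 1 = (node b (i - 1)).label)) :
    Electing ids inp ((A.oblivious C).deliver b i Port.ccw) ∧
      totalCount b < totalCount ((A.oblivious C).deliver b i Port.ccw) := by
  have hstep : (A.oblivious C).step (b.state (neighbor i Port.ccw)) Port.ccw.opp () =
      A.onCcw C (node b (i - 1)) := rfl
  have hfr := h.fresh (i - 1)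
  have hgoal : (node b (i - 1)).ccwCount + 1 ≠ (node b (i - 1)).goal := by
    rw [hfr.goal]; omega
  have h1 := h.ccw i
  have h2 := h.ccw_le i
  have h3 := h.cw_succ_le (i - 1)
  rw [sub_add_cancel] at h3
  have h4 := List.length_pos_of_ne_nil hi
  -- With `h1`, `h3` and `h4` this preserves `ccw_le`: the new count at `i - 1` is at most what `i`
  -- has sent, hence at most `cwCount` of `i`, hence at most what `i - 1` has sent clockwise.
  have h5 : (node b i).ccwSent ≤ (node b i).cwCount := by
    unfold NodeState.ccwSent; split_ifs <;> omega
  have h6 := fun M hM => h.cw_le M hM (i - 1)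
  rw [onCcw, if_neg hfr.dead, if_neg hgoal, if_neg hun] at hstep
  by_cases hlt : (node b (i - 1)).cwCount < (node b (i - 1)).label
  · rw [if_pos hlt] at hstep
    refine ⟨h.deliver hi rfl hstep
      ⟨hfr.pend, hfr.sim, hfr.label, hfr.goal, hfr.joined, hfr.dead⟩ ?_ ?_ ?_ ?_ ?_
      h6 (fun he hle => ?_), totalCount_lt_deliver hi hstep ?_⟩
    · simp
    · simp
    · simp [silent]
    · simp [silent, NodeState.ccwSent, hlt]
    · simp only; omega
    · simp only at he; omega
    · simp only [neighbor_ccw]; omega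
  · rw [if_neg hlt] at hstep
    refine ⟨h.deliver hi rfl hstep
      ⟨hfr.pend, hfr.sim, hfr.label, hfr.goal, hfr.joined, hfr.dead⟩ ?_ ?_ ?_ ?_ ?_
      h6 (fun he hle => ?_), totalCount_lt_deliver hi hstep ?_⟩
    · simp
    · simp
    · split_ifs <;> simp [silent, single]
    · change (((if (node b (i - 1)).label < (node b (i - 1)).ccwCount + 1 then single Port.ccw
          else silent) Port.ccw).length +
        if (node b (i - 1)).cwCount < (node b (i - 1)).label then 0
          else max (node b (i - 1)).ccwCount (node b (i - 1)).label) =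
        if (node b (i - 1)).cwCount < (node b (i - 1)).label then 0
          else max ((node b (i - 1)).ccwCount + 1) (node b (i - 1)).label
      rw [if_neg hlt, if_neg hlt]
      split_ifs <;> simp [silent, single] <;> omega
    · simp only; omega
    · simp only at he hle; exact hun ⟨he, hle⟩
    · simp only [neighbor_ccw]; omega

end Election

end RingAlgorithm

namespace RingAlgorithm

variable {Input : Type u} {Msg : Type v} {Output : Type w}

/-! ### The phases after the election -/

section Simulation

variable {A : RingAlgorithm.{u, v, w, s} Input Msg Output} {C : Coding (List (Entry Msg))} {n : ℕ}

/-- The state of node `i` in the simulation of the configuration `a`, when the last `m` nodes up to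
the owner `o` of the token have joined and the token counter has reached `c`. -/
structure Active (ids : ZMod n → ℕ) (inp : ZMod n → Input) (C : Coding (List (Entry Msg)))
    (a : A.Config n) (τ : ZMod n → Port) (o : ZMod n) (m c : ℕ) (i : ZMod n)
    (x : NodeState A.State) : Prop where
  sim : x.sim = a.state i
  pend : C.decode x.pend = [entry (A.initConfig ids inp) i]
  dead : ¬ x.dead
  turn : x.turn = τ i
  label_le : x.label ≤ x.cwCount
  cw_le : x.cwCount ≤ c
  joined : x.joined ↔ (o - i).val < m

/-- The owner `o` pumps the token counter up to `K`: it has sent a counterclockwise pulse which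
has already increased the counter of the `d` preceding nodes from `c` to `c + 1`. -/
structure Pumping (ids : ZMod n → ℕ) (inp : ZMod n → Input) (b : (A.oblivious C).Config n)
    (a : A.Config n) (τ : ZMod n → Port) (o : ZMod n) (m c K d : ℕ) : Prop where
  active : ∀ i, Active ids inp C a τ o m c i (node b i)
  count : ∀ i, (node b i).ccwCount = if 1 ≤ (o - i).val ∧ (o - i).val ≤ d then c + 1 else c
  goal_le : ∀ i, i ≠ o → (node b i).goal ≤ c
  goal : (node b o).goal = K
  lt : c < K
  chan : b.chan = pulse (o - (d : ZMod n)) Port.ccw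
  d_lt : d < n
  m_le : m ≤ n
  initial : m < n → a = A.initConfig ids inp
  token : C.decode K = view a (o + 1 - m) m

/-- The owner `o` hands the token over to the clockwise neighbour. -/
structure Passing (ids : ZMod n → ℕ) (inp : ZMod n → Input) (b : (A.oblivious C).Config n)
    (a : A.Config n) (τ : ZMod n → Port) (o : ZMod n) (m c : ℕ) : Prop where
  active : ∀ i, Active ids inp C a τ o m c i (node b i)
  count : ∀ i, (node b i).ccwCount = c
  cw_lt : ∀ i, (node b i).cwCount < c
  goal_le : ∀ i, (node b i).goal ≤ c
  chan : b.chan = pulse o Port.cw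
  m_le : m ≤ n
  initial : m < n → a = A.initConfig ids inp
  token : C.decode c = view a (o + 1 - m) m

/-- All nodes of the simulated execution have terminated, no message is in transit, and the `d`
nodes from `h` on have been informed. -/
structure Dying (b : (A.oblivious C).Config n) (a : A.Config n) (h : ZMod n) (d : ℕ) : Prop where
  sim : ∀ i, (node b i).sim = a.state i
  quiescent : a.Quiescent
  terminated : ∀ i, A.Terminated (a.state i)
  d_pos : 1 ≤ d
  d_le : d ≤ n
  dead : ∀ i, (node b i).dead ↔ (i - h).val < d
  joined : ∀ i, ¬ (node b i).dead → (node b i).joined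
  lt_count : ∀ i, ¬ (node b i).dead → max (node b i).cwCount (node b i).label < (node b i).ccwCount
  token : ∀ i, ¬ (node b i).dead → AllDelivered (C.decode (node b i).ccwCount) ∧
    ∀ e ∈ C.decode (node b i).ccwCount, e.2
  chan : b.chan = pulse (h + (d : ZMod n) - 1) Port.cw

/-- The simulation has come to its end. -/
structure Halted (b : (A.oblivious C).Config n) (a : A.Config n) : Prop where
  sim : ∀ i, (node b i).sim = a.state i
  quiescent : b.Quiescent
  quiescent_sim : a.Quiescent
  dead : (∀ i, A.Terminated (a.state i)) → ∀ i, (node b i).dead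

variable {ids : ZMod n → ℕ} {inp : ZMod n → Input} {b : (A.oblivious C).Config n}
  {a : A.Config n} {τ : ZMod n → Port} {o h : ZMod n} {m c K d : ℕ}

theorem Active.mono {i : ZMod n} {x : NodeState A.State} (hx : Active ids inp C a τ o m c i x)
    {c' : ℕ} (hc : c ≤ c') : Active ids inp C a τ o m c' i x :=
  { hx with cw_le := hx.cw_le.trans hc }

/-- The reaction of a node in the simulation to a counterclockwise pulse. -/
theorem onCcw_eq {x : NodeState A.State} (hd : ¬ x.dead) (h1 : x.label ≤ x.cwCount)
    (h2 : x.cwCount ≤ x.ccwCount) :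
    A.onCcw C x = ({ x with ccwCount := x.ccwCount + 1 },
      single (if x.ccwCount + 1 = x.goal then Port.cw else Port.ccw)) := by
  rw [onCcw, if_neg hd]
  split_ifs <;> first | rfl | omega

/-- The effect of the delivery of the only pulse in transit, when the receiver sends one pulse. -/
theorem deliver_pulse_node {i : ZMod n} {p q : Port} (hc : b.chan = pulse i p)
    {x : NodeState A.State}
    (hstep : (A.oblivious C).step (b.state (neighbor i p)) p.opp () = (x, single q)) :
    (∀ k, node ((A.oblivious C).deliver b i p) k = if k = neighbor i p then x else node b k) ∧
      ((A.oblivious C).deliver b i p).chan = pulse (neighbor i p) q := by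
  obtain ⟨h1, h2, -⟩ := (A.oblivious C).deliver_pulse hc
  rw [hstep] at h1 h2
  exact ⟨fun k => congrFun h1 k, h2 q rfl⟩

/-- The effect of the delivery of the only pulse in transit, when the receiver sends nothing. -/
theorem deliver_pulse_node_silent {i : ZMod n} {p : Port} (hc : b.chan = pulse i p)
    {x : NodeState A.State}
    (hstep : (A.oblivious C).step (b.state (neighbor i p)) p.opp () = (x, silent)) :
    (∀ k, node ((A.oblivious C).deliver b i p) k = if k = neighbor i p then x else node b k) ∧
      ((A.oblivious C).deliver b i p).Quiescent := by
  obtain ⟨h1, -, h2⟩ := (A.oblivious C).deliver_pulse hc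
  rw [hstep] at h1 h2
  exact ⟨fun k => congrFun h1 k, h2 rfl⟩

/-- A property of all nodes after a step in which node `j` obtains the state `x`. -/
theorem forall_node_of_update {b' : (A.oblivious C).Config n} {j : ZMod n} {x : NodeState A.State}
    (hb : ∀ k, node b' k = if k = j then x else node b k) {P : ZMod n → NodeState A.State → Prop}
    (hj : P j x) (hne : ∀ k, k ≠ j → P k (node b k)) (k : ZMod n) : P k (node b' k) := by
  rw [hb]
  split_ifs with hk
  · rw [hk]; exact hj
  · exact hne k hk

theorem val_sub_eq_iff [NeZero n] {i : ZMod n} {k : ℕ} (hk : k < n) :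
    (o - i).val = k ↔ i = o - (k : ℕ) := by
  constructor
  · rintro rfl; simp
  · rintro rfl; rw [sub_sub_cancel, ZMod.val_natCast_of_lt hk]

/-- A node other than the owner counts the pulse and forwards it: its own goal is an old one, at
most `c`, and cannot be hit at `c + 1`. -/
theorem Pumping.step_of_lt [NeZero n] (hb : Pumping ids inp b a τ o m c K d) (hd : d + 1 < n) :
    Pumping ids inp ((A.oblivious C).deliver b (o - d) Port.ccw) a τ o m c K (d + 1) := by
  have hj : neighbor (o - (d : ZMod n)) Port.ccw = o - ((d + 1 : ℕ) : ZMod n) := by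
    simp [sub_sub]
  have hval : (o - (o - ((d + 1 : ℕ) : ZMod n))).val = d + 1 := (val_sub_eq_iff hd).mpr rfl
  generalize o - ((d + 1 : ℕ) : ZMod n) = j at *
  have hact := hb.active j
  have hcount : (node b j).ccwCount = c := by
    rw [hb.count, hval, if_neg (by omega)]
  have hjo : j ≠ o := by rintro rfl; simp at hval
  have hgoal := hb.goal_le j hjo
  have hstep : (A.oblivious C).step (b.state (neighbor (o - (d : ZMod n)) Port.ccw))
      Port.ccw.opp () = A.onCcw C (node b j) := by rw [hj]; rfl
  rw [onCcw_eq hact.dead hact.label_le (hact.cw_le.trans_eq hcount.symm), if_neg (by omega)]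
    at hstep
  obtain ⟨hnode, hchan⟩ := deliver_pulse_node hb.chan hstep
  rw [hj] at hnode hchan
  have hjd : j = o - ((d + 1 : ℕ) : ZMod n) := (val_sub_eq_iff hd).mp hval
  refine ⟨forall_node_of_update hnode ⟨hact.sim, hact.pend, hact.dead, hact.turn, hact.label_le,
    hact.cw_le, hact.joined⟩ fun k _ => hb.active k, ?_, ?_, ?_, hb.lt, ?_, hd, hb.m_le,
    hb.initial, hb.token⟩
  · refine forall_node_of_update (P := fun i x => x.ccwCount = _) hnode ?_ fun k hk => ?_
    · rw [hval, if_pos (by omega)]; simp [hcount]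
    · have : (o - k).val ≠ d + 1 := fun hv => hk (hjd ▸ (val_sub_eq_iff hd).mp hv)
      rw [hb.count]
      congr 1
      rw [eq_iff_iff]; omega
  · exact forall_node_of_update (P := fun i x => i ≠ o → x.goal ≤ c) hnode (fun _ => hgoal)
      fun k _ => hb.goal_le k
  · rw [hnode, if_neg hjo.symm]; exact hb.goal
  · rw [hchan, ← hjd]

/-- The pulse returns to its sender, whose counter is the last to move, so all counters agree again.
The owner then starts another round or, having reached its goal, turns the pulse around. -/
theorem Pumping.step_of_eq [NeZero n] (hb : Pumping ids inp b a τ o m c K d) (hd : d + 1 = n) :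
    (c + 1 < K ∧ Pumping ids inp ((A.oblivious C).deliver b (o - d) Port.ccw) a τ o m (c + 1) K 0) ∨
      (c + 1 = K ∧ Passing ids inp ((A.oblivious C).deliver b (o - d) Port.ccw) a τ o m K) := by
  have hj : neighbor (o - (d : ZMod n)) Port.ccw = o := by
    have : ((d + 1 : ℕ) : ZMod n) = 0 := by rw [hd, ZMod.natCast_self]
    rw [neighbor_ccw, sub_sub, ← Nat.cast_succ, this, sub_zero]
  have hact := hb.active o
  have hcount : (node b o).ccwCount = c := by
    rw [hb.count, sub_self, if_neg (by simp)]
  have hstep : (A.oblivious C).step (b.state (neighbor (o - (d : ZMod n)) Port.ccw))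
      Port.ccw.opp () = A.onCcw C (node b o) := by rw [hj]; rfl
  rw [onCcw_eq hact.dead hact.label_le (hact.cw_le.trans_eq hcount.symm), hb.goal, hcount] at hstep
  obtain ⟨hnode, hchan⟩ := deliver_pulse_node hb.chan hstep
  rw [hj] at hnode hchan
  have hcw : ∀ i, (node ((A.oblivious C).deliver b (o - d) Port.ccw) i).cwCount ≤ c :=
    forall_node_of_update (P := fun i x => x.cwCount ≤ c) hnode hact.cw_le
      fun k _ => (hb.active k).cw_le
  have hactive : ∀ i, Active ids inp C a τ o m (c + 1) i
      (node ((A.oblivious C).deliver b (o - d) Port.ccw) i) :=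
    forall_node_of_update hnode ⟨hact.sim, hact.pend, hact.dead, hact.turn, hact.label_le,
      hact.cw_le.trans c.le_succ, hact.joined⟩ fun k _ => (hb.active k).mono c.le_succ
  have hcount' : ∀ i, (node ((A.oblivious C).deliver b (o - d) Port.ccw) i).ccwCount = c + 1 := by
    refine forall_node_of_update (P := fun i x => x.ccwCount = c + 1) hnode rfl fun k hk => ?_
    have h1 : (o - k).val ≠ 0 := by
      rw [Ne, ZMod.val_eq_zero, sub_eq_zero]; exact hk.symm
    have h2 := ZMod.val_lt (o - k)
    rw [hb.count, if_pos (by omega)]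
  have hgoal : ∀ i, i ≠ o → (node ((A.oblivious C).deliver b (o - d) Port.ccw) i).goal ≤ c :=
    fun i hi => by rw [hnode, if_neg hi]; exact hb.goal_le i hi
  have hgoal' : (node ((A.oblivious C).deliver b (o - d) Port.ccw) o).goal = K := by
    rw [hnode, if_pos rfl]
  rcases (Nat.succ_le_of_lt hb.lt).lt_or_eq with hK | hK
  · rw [if_neg hK.ne] at hchan
    refine Or.inl ⟨hK, hactive, fun i => ?_, fun i hi => (hgoal i hi).trans c.le_succ, hgoal', hK,
      ?_, NeZero.pos n, hb.m_le, hb.initial, hb.token⟩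
    · rw [hcount', if_neg (by omega)]
    · simpa using hchan
  · rw [if_pos hK] at hchan
    refine Or.inr ⟨hK, hK ▸ hactive, hK ▸ hcount', fun i => ?_, fun i => ?_, hchan, hb.m_le,
      hb.initial, hb.token⟩
    · exact (Nat.lt_succ_of_le (hcw i)).trans_eq hK
    · by_cases hi : i = o
      · rw [hi, hgoal']
      · exact (hgoal i hi).trans hb.lt.le

theorem val_succ_sub_lt_iff [NeZero n] (i : ZMod n) :
    (o + 1 - i).val < m + 1 ↔ i = o + 1 ∨ (o - i).val < m := by
  have e : o + 1 - i = o - i + 1 := by ring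
  rw [e, val_add_one]
  have h0 : o - i + 1 = 0 ↔ i = o + 1 := by
    rw [← e, sub_eq_zero, eq_comm]
  by_cases hi : i = o + 1
  · rw [if_pos (h0.mpr hi)]; simp [hi]
  · rw [if_neg (h0.not.mpr hi)]; simp [hi]

theorem val_sub_succ [NeZero n] : (o - (o + 1)).val = n - 1 := by
  have := (val_sub_eq_iff (o := o) (i := o + 1) (k := n - 1)
    (Nat.sub_lt (NeZero.pos n) one_pos)).mpr
  apply this
  simp [Nat.cast_sub (NeZero.one_le (n := n))]

/-- The counter has been pumped strictly beyond every `cwCount`, which is at least the label, so the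
clockwise pulse is read as a token. -/
theorem Passing.onCw_eq (hb : Passing ids inp b a τ o m c) (i : ZMod n) :
    A.onCw C (node b i) = A.act C (node b i) (C.decode c) := by
  have h1 := hb.cw_lt i
  have h2 := (hb.active i).label_le
  rw [onCw, if_neg (hb.active i).dead, hb.count, if_pos (max_lt h1 (h2.trans_lt h1))]

/-- The receiver has not joined yet and appends its own initial entry. This entry is still accurate
because no delivery is simulated before all nodes have joined. -/
theorem Passing.step_of_lt [NeZero n] (hb : Passing ids inp b a τ o m c) (hm : m < n) :
    simEvent A C b (some (o, Port.cw)) = none ∧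
    ∃ K, Pumping ids inp ((A.oblivious C).deliver b o Port.cw) a τ (o + 1) (m + 1) c K 0 := by
  have hact := hb.active (o + 1)
  have hj : ¬ (node b (o + 1)).joined := by
    rw [hact.joined, val_sub_succ]; omega
  refine ⟨if_neg fun hh => hj hh.2.1, C.code c (C.decode c ++ C.decode (node b (o + 1)).pend), ?_⟩
  have hstep : (A.oblivious C).step (b.state (neighbor o Port.cw)) Port.cw.opp () =
      A.onCw C (node b (o + 1)) := rfl
  rw [hb.onCw_eq, act, if_neg hj] at hstep
  obtain ⟨hnode, hchan⟩ := deliver_pulse_node hb.chan hstep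
  rw [neighbor_cw] at hnode hchan
  refine ⟨?_, ?_, ?_, ?_, C.lt_code _ _, ?_,
    NeZero.pos n, hm, fun _ => hb.initial hm, ?_⟩
  · refine forall_node_of_update hnode ⟨hact.sim, hact.pend, hact.dead, hact.turn, hact.label_le,
      hact.cw_le, ?_⟩ fun k hk => { hb.active k with joined := ?_ }
    · rw [val_succ_sub_lt_iff]; simp
    · rw [(hb.active k).joined, val_succ_sub_lt_iff]; simp [hk]
  · intro i
    rw [if_neg (by omega)]
    exact forall_node_of_update (P := fun i x => x.ccwCount = c) hnode (hb.count _)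
      (fun k _ => hb.count k) i
  · intro i hi
    rw [hnode, if_neg hi]
    exact hb.goal_le i
  · rw [hnode, if_pos rfl, hb.count]
  · simpa using hchan
  · rw [C.decode_code, hb.token, hact.pend]
    have e1 : o + 1 + 1 - ((m + 1 : ℕ) : ZMod n) = o + 1 - m := by push_cast; ring
    rw [e1, view_succ, sub_add_cancel, hb.initial hm]

theorem deliver_state_of_ne {c : A.Config n} {i k : ZMod n} {p : Port} (hk : k ≠ neighbor i p) :
    (A.deliver c i p).state k = c.state k := by
  rcases hc : c.chan i p with _ | ⟨m, l⟩
  · rw [A.deliver_nil hc]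
  · rw [A.deliver_cons hc]; simp [hk]

theorem Passing.token_full [NeZero n] (hb : Passing ids inp b a τ o n c) :
    C.decode c = view a (o + 1) n := by
  rw [hb.token, ZMod.natCast_self, sub_zero]

theorem Passing.joined [NeZero n] (hb : Passing ids inp b a τ o n c) (i : ZMod n) :
    (node b i).joined :=
  (hb.active i).joined.mpr (ZMod.val_lt _)

theorem Passing.simEvent_eq [NeZero n] (hb : Passing ids inp b a τ o n c) (ha : ¬ a.Quiescent) :
    simEvent A C b (some (o, Port.cw)) =
      some (neighbor (o + 1) (τ (o + 1)), (τ (o + 1)).opp) := by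
  have hact := hb.active (o + 1)
  have hc := hb.count (o + 1)
  have h1 : b.chan o Port.cw ≠ [] := by rw [hb.chan, pulse_self]; simp
  have h2 : ¬ AllDelivered (C.decode (node b (o + 1)).ccwCount) := by
    rwa [hc, hb.token_full, allDelivered_view]
  rw [← hact.turn]
  exact if_pos ⟨h1, hb.joined _, hact.dead, h2⟩

/-- The channel whose turn it is may be empty. Then the simulated step changes nothing, but the port
still alternates and the rotated token is still passed on. -/
theorem Passing.step_of_not_quiescent [NeZero n] (hb : Passing ids inp b a τ o n c)
    (ha : ¬ a.Quiescent) :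
    ∃ K, Pumping ids inp ((A.oblivious C).deliver b o Port.cw)
      (A.deliver a (neighbor (o + 1) (τ (o + 1))) (τ (o + 1)).opp)
      (Function.update τ (o + 1) (τ (o + 1)).opp) (o + 1) n c K 0 := by
  have hact := hb.active (o + 1)
  have hstep : (A.oblivious C).step (b.state (neighbor o Port.cw)) Port.cw.opp () =
      A.onCw C (node b (o + 1)) := rfl
  have hcount := hb.count (o + 1)
  rw [hb.onCw_eq, act, if_pos (hb.joined _), hb.token_full,
    if_neg (by rwa [allDelivered_view]), hact.sim, hact.turn, advance_view, rotate_view, hcount]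
    at hstep
  obtain ⟨hnode, hchan⟩ := deliver_pulse_node hb.chan hstep
  rw [neighbor_cw] at hnode hchan
  refine ⟨C.code c (view (A.deliver a (neighbor (o + 1) (τ (o + 1))) (τ (o + 1)).opp)
    (o + 1 + 1) n), ?_, ?_, ?_, ?_, C.lt_code _ _, ?_, NeZero.pos n, le_rfl,
    fun hlt => absurd hlt (lt_irrefl n), ?_⟩
  rotate_left 3
  · rw [hnode, if_pos rfl]
  · simpa using hchan
  · rw [C.decode_code, ZMod.natCast_self, sub_zero]
  · refine forall_node_of_update hnode ⟨rfl, hact.pend, hact.dead, ?_, hact.label_le,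
      hact.cw_le, ?_⟩ fun k hk => { hb.active k with sim := ?_, turn := ?_, joined := ?_ }
    · simp
    · exact iff_of_true (hb.joined _) (ZMod.val_lt _)
    · rw [(hb.active k).sim, deliver_state_of_ne (by simpa using hk)]
    · rw [(hb.active k).turn, Function.update_of_ne hk]
    · exact iff_of_true (hb.joined _) (ZMod.val_lt _)
  · intro i
    rw [if_neg (by omega)]
    exact forall_node_of_update (P := fun i x => x.ccwCount = c) hnode rfl
      (fun k _ => hb.count k) i
  · intro i hi
    rw [hnode, if_neg hi]
    exact hb.goal_le i

/-- A simulated execution without messages in transit never changes again. So silence is right if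
some node has not terminated, and otherwise the last tour begins. -/
theorem Passing.step_of_quiescent [NeZero n] (hb : Passing ids inp b a τ o n c)
    (ha : a.Quiescent) :
    Dying ((A.oblivious C).deliver b o Port.cw) a (o + 1) 1 ∨
      Halted ((A.oblivious C).deliver b o Port.cw) a := by
  have hact := hb.active (o + 1)
  have hstep : (A.oblivious C).step (b.state (neighbor o Port.cw)) Port.cw.opp () =
      A.onCw C (node b (o + 1)) := rfl
  have hcount := hb.count (o + 1)
  have hall : AllDelivered (C.decode c) := by rwa [hb.token_full, allDelivered_view]
  have hterm : (∀ e ∈ C.decode c, e.2) ↔ ∀ i, A.Terminated (a.state i) := by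
    rw [hb.token_full]; exact A.forall_mem_view a _ fun e => e.2
  rw [hb.onCw_eq, act, if_pos (hb.joined _), if_pos hall] at hstep
  by_cases ht : ∀ i, A.Terminated (a.state i)
  · rw [if_pos (hterm.mpr ht)] at hstep
    obtain ⟨hnode, hchan⟩ := deliver_pulse_node hb.chan hstep
    rw [neighbor_cw] at hnode hchan
    refine Or.inl ⟨?_, ha, ht, le_rfl, NeZero.pos n, ?_, ?_, ?_, ?_, ?_⟩
    · exact forall_node_of_update (P := fun i x => x.sim = a.state i) hnode hact.sim
        fun k _ => (hb.active k).sim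
    · refine forall_node_of_update (P := fun i x => x.dead ↔ (i - (o + 1)).val < 1) hnode (by simp)
        fun k hk => iff_of_false (hb.active k).dead ?_
      rw [Nat.lt_one_iff, ZMod.val_eq_zero, sub_eq_zero]
      exact hk
    · exact forall_node_of_update (P := fun i x => ¬ x.dead → x.joined) hnode
        (fun _ => hb.joined _) fun k _ _ => hb.joined k
    · refine forall_node_of_update (P := fun i x => ¬ x.dead → max x.cwCount x.label < x.ccwCount)
        hnode (fun hh => absurd trivial hh) fun k _ _ => ?_
      rw [hb.count]
      exact max_lt (hb.cw_lt k) ((hb.active k).label_le.trans_lt (hb.cw_lt k))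
    · refine forall_node_of_update (P := fun i x => ¬ x.dead → AllDelivered (C.decode x.ccwCount) ∧
        ∀ e ∈ C.decode x.ccwCount, e.2) hnode (fun hh => absurd trivial hh) fun k _ _ => ?_
      rw [hb.count]
      exact ⟨hall, hterm.mpr ht⟩
    · simpa using hchan
  · rw [if_neg (hterm.not.mpr ht)] at hstep
    obtain ⟨hnode, hq⟩ := deliver_pulse_node_silent hb.chan hstep
    rw [neighbor_cw] at hnode
    exact Or.inr ⟨forall_node_of_update (P := fun i x => x.sim = a.state i) hnode hact.sim
      fun k _ => (hb.active k).sim, hq, ha, fun hh => absurd hh ht⟩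

/-- Living nodes still hold the counter that encodes the final token, so each draws the same
conclusion when the clockwise pulse arrives. After the full tour the pulse meets the first dead node
and is swallowed. -/
theorem Dying.step [NeZero n] (hb : Dying b a h d) :
    (d < n ∧ Dying ((A.oblivious C).deliver b (h + d - 1) Port.cw) a h (d + 1)) ∨
      Halted ((A.oblivious C).deliver b (h + d - 1) Port.cw) a := by
  have hj : neighbor (h + (d : ZMod n) - 1) Port.cw = h + (d : ZMod n) := by simp
  have hstep : (A.oblivious C).step (b.state (neighbor (h + (d : ZMod n) - 1) Port.cw))
      Port.cw.opp () = A.onCw C (node b (h + (d : ZMod n))) := by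
    rw [hj]; rfl
  rcases hb.d_le.lt_or_eq with hd | hd
  · have hval : ∀ i, (i - h).val = d ↔ i = h + (d : ℕ) := fun i => by
      constructor
      · rintro rfl; simp
      · rintro rfl; rw [add_sub_cancel_left, ZMod.val_natCast_of_lt hd]
    have hnd : ¬ (node b (h + d)).dead := by
      rw [hb.dead, (hval _).mpr rfl]; omega
    rw [onCw, if_neg hnd, if_pos (hb.lt_count _ hnd), act, if_pos (hb.joined _ hnd),
      if_pos (hb.token _ hnd).1, if_pos (hb.token _ hnd).2] at hstep
    obtain ⟨hnode, hchan⟩ := deliver_pulse_node hb.chan hstep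
    rw [hj] at hnode hchan
    refine Or.inl ⟨hd, ?_, hb.quiescent, hb.terminated, by omega, hd, ?_, ?_, ?_, ?_, ?_⟩
    · exact forall_node_of_update (P := fun i x => x.sim = a.state i) hnode (hb.sim _)
        fun k _ => hb.sim k
    · refine forall_node_of_update (P := fun i x => x.dead ↔ (i - h).val < d + 1) hnode ?_
        fun k hk => ?_
      · exact iff_of_true trivial (by rw [(hval _).mpr rfl]; omega)
      · have := (hval k).not.mpr hk
        rw [hb.dead]; omega
    · exact forall_node_of_update (P := fun i x => ¬ x.dead → x.joined) hnode
        (fun hh => absurd trivial hh) fun k _ => hb.joined k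
    · exact forall_node_of_update (P := fun i x => ¬ x.dead → max x.cwCount x.label < x.ccwCount)
        hnode (fun hh => absurd trivial hh) fun k _ => hb.lt_count k
    · exact forall_node_of_update (P := fun i x => ¬ x.dead → AllDelivered (C.decode x.ccwCount) ∧
        ∀ e ∈ C.decode x.ccwCount, e.2) hnode (fun hh => absurd trivial hh) fun k _ => hb.token k
    · rw [hchan]; congr 1; push_cast; ring
  · have hdead : ∀ i, (node b i).dead := fun i => (hb.dead i).mpr
      ((ZMod.val_lt _).trans_eq hd.symm)
    rw [onCw, if_pos (hdead _)] at hstep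
    obtain ⟨hnode, hq⟩ := deliver_pulse_node_silent hb.chan hstep
    rw [hj] at hnode
    refine Or.inr ⟨?_, hq, hb.quiescent, fun _ => ?_⟩
    · exact forall_node_of_update (P := fun i x => x.sim = a.state i) hnode (hb.sim _)
        fun k _ => hb.sim k
    · exact forall_node_of_update (P := fun i x => x.dead) hnode (hdead _) fun k _ => hdead k

/-- Soundness fixes all counts just before the decisive delivery: every node has sent `R` pulses in
each direction and received `R`, except that the leader lacks one counterclockwise pulse. That pulse
is therefore the only one in transit. -/
theorem Electing.deliver_leader [NeZero n] (hb : Electing ids inp b)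
    (hids : Function.Injective ids) {i : ZMod n} (hi : b.chan i Port.ccw ≠ [])
    (hlead : (node b (i - 1)).cwCount = (node b (i - 1)).label ∧
      (node b (i - 1)).ccwCount + 1 = (node b (i - 1)).label) :
    ∃ c K, Pumping ids inp ((A.oblivious C).deliver b i Port.ccw) (A.initConfig ids inp)
      (fun k => (node b k).turn) (i - 1) 1 c K 0 := by
  have h1 := hb.ccw i
  have h4 := List.length_pos_of_ne_nil hi
  obtain ⟨hall, -⟩ := hb.sound hids (j := i - 1) hlead.1.le (by rw [sub_add_cancel]; omega)
  have hfr := hb.fresh (i - 1)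
  set j := i - 1 with hjdef
  set R := (node b j).label with hR
  have hcw : ∀ k, (node b k).cwCount = R := fun k => by
    by_cases hk : k = j
    · rw [hk]; exact hlead.1
    · exact (hall k hk).2.1
  have hlab : ∀ k, (node b k).label ≤ R := fun k => by
    by_cases hk : k = j
    · rw [hk]
    · exact (hall k hk).1.le
  have hccw : ∀ k, (node b k).ccwCount + (if k = j then 1 else 0) = R := fun k => by
    by_cases hk : k = j
    · rw [if_pos hk, hk]; exact hlead.2
    · rw [if_neg hk]; exact (hall k hk).2.2
  have hchan : b.chan = pulse i Port.ccw := by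
    funext k p
    have hlen : (b.chan k p).length = (pulse i Port.ccw k p).length := by
      have e : k - 1 = j ↔ k = i := sub_left_inj
      cases p
      · have h2 := hb.ccw k
        have h3 := hccw (k - 1)
        have h5 := hccw k
        rw [NodeState.ccwSent, if_neg (by rw [hcw]; exact (hlab k).not_gt)] at h2
        have h6 := hlab k
        simp only [e] at h3
        have h7 : max (node b k).ccwCount (node b k).label = R := by
          by_cases hk : k = j
          · rw [hk, ← hR]; omega
          · rw [if_neg hk] at h5; omega
        by_cases hk : k = i
        · simp only [hk, if_true] at h3
          simp only [pulse, hk, and_self, if_true, List.length_singleton]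
          rw [hk] at h2 h7
          omega
        · simp only [hk, if_false] at h3
          simp only [pulse, hk, false_and, if_false, List.length_nil]
          omega
      · have h2 := hb.cw k
        have h6 := hlab k
        rw [hcw, hcw] at h2
        simp only [pulse, reduceCtorEq, and_false, if_false, List.length_nil]
        omega
    -- Pulses carry no content, so lists of pulses of equal length are equal.
    exact List.ext_getElem hlen fun _ _ _ => rfl
  have hstep : (A.oblivious C).step (b.state (neighbor i Port.ccw)) Port.ccw.opp () =
      A.onCcw C (node b j) := rfl
  rw [onCcw, if_neg hfr.dead, if_neg (by rw [hfr.goal]; omega),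
    if_neg (by rw [hlead.1]; exact lt_irrefl _), if_pos hlead, act, if_neg hfr.joined,
    List.nil_append, hfr.pend] at hstep
  obtain ⟨hnode, hchan'⟩ := deliver_pulse_node hchan hstep
  rw [neighbor_ccw, ← hjdef] at hnode hchan'
  refine ⟨R, C.code R [entry (A.initConfig ids inp) j], ?_, ?_, ?_, ?_, C.lt_code _ _, ?_,
    NeZero.pos n, NeZero.pos n, fun _ => rfl, ?_⟩
  rotate_left 3
  · rw [hnode, if_pos rfl, hlead.2]
  · simpa using hchan'
  · rw [C.decode_code]; simp [view]
  · refine forall_node_of_update hnode ⟨hfr.sim, hfr.pend, hfr.dead, rfl, hlead.1.ge,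
      hlead.1.le, ?_⟩ fun k hk => ⟨(hb.fresh k).sim, (hb.fresh k).pend, (hb.fresh k).dead, rfl,
      by rw [hcw]; exact hlab k, (hcw k).le, iff_of_false (hb.fresh k).joined ?_⟩
    · simp
    · rw [Nat.lt_one_iff, ZMod.val_eq_zero, sub_eq_zero]
      exact fun hh => hk hh.symm
  · intro k
    rw [if_neg (by omega)]
    refine forall_node_of_update (P := fun i x => x.ccwCount = R) hnode hlead.2 (fun k hk => ?_) k
    exact (hall k hk).2.2
  · intro k hk
    rw [hnode, if_neg hk, (hb.fresh k).goal]
    exact Nat.zero_le _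

end Simulation

end RingAlgorithm

namespace RingAlgorithm

variable {Input : Type u} {Msg : Type v} {Output : Type w}

/-! ### The simulation relation and its preservation -/

section Relation

variable {A : RingAlgorithm.{u, v, w, s} Input Msg Output} {C : Coding (List (Entry Msg))} {n : ℕ}

/-- The relation between the configurations of the simulation and of the simulated execution. -/
inductive Related (ids : ZMod n → ℕ) (inp : ZMod n → Input) (b : (A.oblivious C).Config n)
    (a : A.Config n) : Prop
  | electing (h : Electing ids inp b) (ha : a = A.initConfig ids inp)
  | pumping (τ : ZMod n → Port) (o : ZMod n) (m c K d : ℕ) (h : Pumping ids inp b a τ o m c K d)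
  | passing (τ : ZMod n → Port) (o : ZMod n) (m c : ℕ) (h : Passing ids inp b a τ o m c)
  | dying (o : ZMod n) (d : ℕ) (h : Dying b a o d)
  | halted (h : Halted b a)

variable {ids : ZMod n → ℕ} {inp : ZMod n → Input} {b : (A.oblivious C).Config n}
  {a : A.Config n} {τ : ZMod n → Port} {o : ZMod n} {m c K d : ℕ}

theorem Related.sim (h : Related ids inp b a) (i : ZMod n) : (node b i).sim = a.state i := by
  rcases h with ⟨h, rfl⟩ | ⟨_, _, _, _, _, _, h⟩ | ⟨_, _, _, _, h⟩ | ⟨_, _, h⟩ | h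
  · exact (h.fresh i).sim
  · exact (h.active i).sim
  · exact (h.active i).sim
  · exact h.sim i
  · exact h.sim i

theorem simEvent_nil {i : ZMod n} {p : Port} (h : b.chan i p = []) :
    simEvent A C b (some (i, p)) = none := by
  cases p
  · rfl
  · exact if_neg fun hh => hh.1 h

theorem Electing.simEvent_eq (h : Electing ids inp b) (e : Option (ZMod n × Port)) :
    simEvent A C b e = none := by
  rcases e with _ | ⟨i, _ | _⟩
  · rfl
  · rfl
  · exact if_neg fun hh => (h.fresh _).joined hh.2.1

theorem Electing.step [NeZero n] (h : Electing ids inp b) (hids : Function.Injective ids)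
    {i : ZMod n} {p : Port} (hi : b.chan i p ≠ []) :
    (Electing ids inp ((A.oblivious C).deliver b i p) ∧
      totalCount b < totalCount ((A.oblivious C).deliver b i p)) ∨
    ∃ τ o c K, Pumping ids inp ((A.oblivious C).deliver b i p) (A.initConfig ids inp) τ o 1 c K 0 := by
  cases p
  · by_cases hl : (node b (i - 1)).cwCount = (node b (i - 1)).label ∧
      (node b (i - 1)).ccwCount + 1 = (node b (i - 1)).label
    · obtain ⟨c, K, hp⟩ := h.deliver_leader hids hi hl
      exact Or.inr ⟨_, _, c, K, hp⟩
    · exact Or.inl (h.deliver_ccw hi hl)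
  · exact Or.inl (h.deliver_cw hids hi)

theorem eq_of_pulse_ne_nil {j i : ZMod n} {q p : Port} (hc : b.chan = pulse j q)
    (h : b.chan i p ≠ []) : i = j ∧ p = q := by
  rw [hc, pulse] at h
  by_contra hne
  exact h (if_neg hne)

theorem Related.next [NeZero n] (h : Related ids inp b a) (hids : Function.Injective ids)
    (e : Option (ZMod n × Port)) :
    Related ids inp ((A.oblivious C).next b e) (A.next a (simEvent A C b e)) := by
  rcases e with _ | ⟨i, p⟩
  · exact h
  · by_cases hc : b.chan i p = []
    · rw [simEvent_nil hc]
      simpa only [RingAlgorithm.next, (A.oblivious C).deliver_nil hc] using h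
    · rcases h with ⟨h, rfl⟩ | ⟨τ, o, m, c, K, d, h⟩ | ⟨τ, o, m, c, h⟩ | ⟨o, d, h⟩ | h
      · rw [h.simEvent_eq]
        rcases h.step hids hc with ⟨h, -⟩ | ⟨τ, o, c, K, h⟩
        · exact .electing h rfl
        · exact .pumping τ o 1 c K 0 h
      · obtain ⟨rfl, rfl⟩ := eq_of_pulse_ne_nil h.chan hc
        rcases (Nat.succ_le_of_lt h.d_lt).lt_or_eq with hd | hd
        · exact .pumping τ o m c K (d + 1) (h.step_of_lt hd)
        · rcases h.step_of_eq hd with ⟨-, h⟩ | ⟨-, h⟩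
          · exact .pumping τ o m (c + 1) K 0 h
          · exact .passing τ o m K h
      · obtain ⟨rfl, rfl⟩ := eq_of_pulse_ne_nil h.chan hc
        rcases h.m_le.lt_or_eq with hm | rfl
        · obtain ⟨h1, K, h2⟩ := h.step_of_lt hm
          rw [h1]
          exact .pumping τ _ _ c K 0 h2
        · by_cases ha : a.Quiescent
          · rw [ha.next_eq]
            rcases h.step_of_quiescent ha with h | h
            · exact .dying _ _ h
            · exact .halted h
          · obtain ⟨K, h2⟩ := h.step_of_not_quiescent ha
            rw [h.simEvent_eq ha]
            exact .pumping _ _ _ c K 0 h2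
      · obtain ⟨rfl, rfl⟩ := eq_of_pulse_ne_nil h.chan hc
        rw [h.quiescent.next_eq]
        rcases h.step with ⟨-, h⟩ | h
        · exact .dying _ _ h
        · exact .halted h
      · exact absurd (h.quiescent i p) hc

end Relation

/-! ### Progress and fairness along an execution -/

section Schedules

variable (A : RingAlgorithm.{u, v, w, s} Input Msg Output) (C : Coding (List (Entry Msg))) {n : ℕ}
  (ids : ZMod n → ℕ) (inp : ZMod n → Input) (σ : Schedule n)

/-- The schedule of the simulated execution. -/
noncomputable def simSchedule : Schedule n :=
  fun t => simEvent A C ((A.oblivious C).run ids inp σ t) (σ t)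

/-- Some time from `t` on, the configurations of the simulation and of the simulated execution
satisfy `P`. -/
def Reaches (t : ℕ) (P : (A.oblivious C).Config n → A.Config n → Prop) : Prop :=
  ∃ t', t ≤ t' ∧ P ((A.oblivious C).run ids inp σ t') (A.run ids inp (A.simSchedule C ids inp σ) t')

variable {A C ids inp σ}

theorem Reaches.refl {t : ℕ} {P : (A.oblivious C).Config n → A.Config n → Prop}
    (h : P ((A.oblivious C).run ids inp σ t) (A.run ids inp (A.simSchedule C ids inp σ) t)) :
    A.Reaches C ids inp σ t P :=
  ⟨t, le_rfl, h⟩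

theorem Reaches.trans {t : ℕ} {P Q : (A.oblivious C).Config n → A.Config n → Prop}
    (h : A.Reaches C ids inp σ t P)
    (h' : ∀ t', t ≤ t' →
      P ((A.oblivious C).run ids inp σ t') (A.run ids inp (A.simSchedule C ids inp σ) t') →
      A.Reaches C ids inp σ t' Q) : A.Reaches C ids inp σ t Q := by
  obtain ⟨t', ht, hP⟩ := h
  obtain ⟨t'', ht', hQ⟩ := h' t' ht hP
  exact ⟨t'', ht.trans ht', hQ⟩

theorem related_run [NeZero n] (hids : Function.Injective ids) (t : ℕ) :
    Related ids inp ((A.oblivious C).run ids inp σ t)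
      (A.run ids inp (A.simSchedule C ids inp σ) t) := by
  induction t with
  | zero => exact .electing (electing_init ids inp) rfl
  | succ t ih => rw [run_succ, run_succ]; exact ih.next hids _

/-- Until a nonempty channel is served both configurations are frozen. The given channel would thus
still be nonempty when fairness serves it. -/
theorem exists_delivery (hf : (A.oblivious C).Fair ids inp σ) {t : ℕ} {i : ZMod n} {p : Port}
    (h : ((A.oblivious C).run ids inp σ t).chan i p ≠ []) :
    ∃ t', t ≤ t' ∧ (A.oblivious C).run ids inp σ t' = (A.oblivious C).run ids inp σ t ∧
      A.run ids inp (A.simSchedule C ids inp σ) t' = A.run ids inp (A.simSchedule C ids inp σ) t ∧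
      ∃ j q, σ t' = some (j, q) ∧ ((A.oblivious C).run ids inp σ t).chan j q ≠ [] := by
  by_contra! hcon
  have key : ∀ t', t ≤ t' →
      (A.oblivious C).run ids inp σ t' = (A.oblivious C).run ids inp σ t ∧
      A.run ids inp (A.simSchedule C ids inp σ) t' =
        A.run ids inp (A.simSchedule C ids inp σ) t := fun t' ht => by
    induction t', ht using Nat.le_induction with
    | base => exact ⟨rfl, rfl⟩
    | succ k hk ih =>
      have := hcon k hk ih.1 ih.2
      rw [run_succ, run_succ, simSchedule, ih.1, ih.2]
      rcases hs : σ k with _ | ⟨j, q⟩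
      · exact ⟨rfl, rfl⟩
      · have hn := this j q hs
        rw [simEvent_nil hn]
        exact ⟨(A.oblivious C).deliver_nil hn, rfl⟩
  obtain ⟨t', ht, hs⟩ := hf t i p h
  exact h (hcon t' ht (key t' ht).1 (key t' ht).2 i p hs)

theorem exists_pulse_delivery (hf : (A.oblivious C).Fair ids inp σ) {t : ℕ} {i : ZMod n}
    {p : Port} (h : ((A.oblivious C).run ids inp σ t).chan = pulse i p) :
    ∃ t', t ≤ t' ∧ A.simSchedule C ids inp σ t' =
        simEvent A C ((A.oblivious C).run ids inp σ t) (some (i, p)) ∧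
      (A.oblivious C).run ids inp σ (t' + 1) =
        (A.oblivious C).deliver ((A.oblivious C).run ids inp σ t) i p ∧
      A.run ids inp (A.simSchedule C ids inp σ) (t' + 1) =
        A.next (A.run ids inp (A.simSchedule C ids inp σ) t)
          (simEvent A C ((A.oblivious C).run ids inp σ t) (some (i, p))) := by
  obtain ⟨t', ht, h1, h2, j, q, hs, hc⟩ := exists_delivery hf (t := t) (i := i) (p := p)
    (by rw [h, pulse_self]; simp)
  obtain ⟨rfl, rfl⟩ := eq_of_pulse_ne_nil h hc
  have h3 : A.simSchedule C ids inp σ t' =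
      simEvent A C ((A.oblivious C).run ids inp σ t) (some (j, q)) := by
    rw [simSchedule, h1, hs]
  refine ⟨t', ht, h3, ?_, ?_⟩
  · rw [run_succ, h1, hs]; rfl
  · rw [run_succ, h3, h2]

theorem Pumping.reaches_round [NeZero n] (hf : (A.oblivious C).Fair ids inp σ)
    {τ : ZMod n → Port} {o : ZMod n} {m c K : ℕ} (e : ℕ) {d t : ℕ} (he : d + 1 + e = n)
    (h : Pumping ids inp ((A.oblivious C).run ids inp σ t)
      (A.run ids inp (A.simSchedule C ids inp σ) t) τ o m c K d) :
    A.Reaches C ids inp σ t fun b a => (c + 1 < K ∧ Pumping ids inp b a τ o m (c + 1) K 0) ∨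
      (c + 1 = K ∧ Passing ids inp b a τ o m K) := by
  induction e generalizing d t with
  | zero =>
    obtain ⟨t', ht, -, h1, h2⟩ := exists_pulse_delivery hf h.chan
    refine ⟨t' + 1, by omega, ?_⟩
    rw [h1, h2]
    exact h.step_of_eq he
  | succ e ih =>
    obtain ⟨t', ht, -, h1, h2⟩ := exists_pulse_delivery hf h.chan
    have h3 : A.Reaches C ids inp σ t fun b a => Pumping ids inp b a τ o m c K (d + 1) := by
      refine ⟨t' + 1, by omega, ?_⟩
      rw [h1, h2]
      exact h.step_of_lt (by omega)
    exact h3.trans fun _ _ => ih (by omega)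

theorem Pumping.reaches_passing [NeZero n] (hf : (A.oblivious C).Fair ids inp σ)
    {τ : ZMod n → Port} {o : ZMod n} {m c K d t : ℕ}
    (h : Pumping ids inp ((A.oblivious C).run ids inp σ t)
      (A.run ids inp (A.simSchedule C ids inp σ) t) τ o m c K d) :
    A.Reaches C ids inp σ t fun b a => Passing ids inp b a τ o m K := by
  obtain ⟨e, he⟩ : ∃ e, c + e = K := ⟨K - c, by have := h.lt; omega⟩
  induction e generalizing c d t with
  | zero => exact absurd h.lt (by omega)
  | succ e ih =>
    refine (h.reaches_round hf (n - d - 1) (by have := h.d_lt; omega)).trans fun t' _ h' => ?_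
    rcases h' with ⟨_, h'⟩ | ⟨_, h'⟩
    · exact ih h' (by omega)
    · exact .refl h'

/-- Each effective delivery of the election raises `totalCount`, which is bounded, so eventually one
of them elects the leader. -/
theorem Electing.reaches_passing [NeZero n] (hf : (A.oblivious C).Fair ids inp σ)
    (hids : Function.Injective ids) {t : ℕ}
    (h : Electing ids inp ((A.oblivious C).run ids inp σ t))
    (ha : A.run ids inp (A.simSchedule C ids inp σ) t = A.initConfig ids inp) :
    A.Reaches C ids inp σ t fun b a => ∃ τ o K, Passing ids inp b a τ o 1 K := by
  obtain ⟨M, hM⟩ : ∃ M, ∀ i, ids i + 1 ≤ M := by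
    obtain ⟨j, hj⟩ := Finite.exists_max ids
    exact ⟨ids j + 1, fun i => Nat.succ_le_succ (hj i)⟩
  obtain ⟨e, he⟩ : ∃ e, n * (2 * M) - totalCount ((A.oblivious C).run ids inp σ t) = e := ⟨_, rfl⟩
  induction e using Nat.strong_induction_on generalizing t with
  | _ e ih =>
    obtain ⟨i, p, hc⟩ := h.exists_chan_ne_nil
    obtain ⟨t', ht, h1, h2, j, q, hs, hc⟩ := exists_delivery hf hc
    have hb : (A.oblivious C).run ids inp σ (t' + 1) =
        (A.oblivious C).deliver ((A.oblivious C).run ids inp σ t) j q := by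
      rw [run_succ, h1, hs]; rfl
    have ha' : A.run ids inp (A.simSchedule C ids inp σ) (t' + 1) = A.initConfig ids inp := by
      rw [run_succ, simSchedule, h1, h.simEvent_eq, ← ha]; exact h2
    have hstep := h.step hids hc
    rw [← hb] at hstep
    refine Reaches.trans (P := fun b a => b = (A.oblivious C).run ids inp σ (t' + 1) ∧
      a = A.run ids inp (A.simSchedule C ids inp σ) (t' + 1)) ⟨t' + 1, by omega, rfl, rfl⟩ ?_
    rintro t'' - ⟨hb', ha''⟩
    rw [← hb'] at hstep
    rw [← ha''] at ha'
    rcases hstep with ⟨h', hlt⟩ | ⟨τ, o, c, K, h'⟩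
    · have := h'.totalCount_le hM
      exact ih _ (by omega) h' ha' rfl
    · rw [← ha'] at h'
      exact (h'.reaches_passing hf).trans fun _ _ h => .refl ⟨τ, o, K, h⟩

theorem Passing.reaches_full [NeZero n] (hf : (A.oblivious C).Fair ids inp σ)
    {τ : ZMod n → Port} {o : ZMod n} {m c t : ℕ}
    (h : Passing ids inp ((A.oblivious C).run ids inp σ t)
      (A.run ids inp (A.simSchedule C ids inp σ) t) τ o m c) :
    A.Reaches C ids inp σ t fun b a => ∃ τ o c, Passing ids inp b a τ o n c := by
  obtain ⟨e, he⟩ : ∃ e, m + e = n := ⟨n - m, by have := h.m_le; omega⟩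
  induction e generalizing m o c t with
  | zero =>
    obtain rfl : m = n := he
    exact .refl ⟨τ, o, c, h⟩
  | succ e ih =>
    obtain ⟨h0, K, hp⟩ := h.step_of_lt (by omega)
    obtain ⟨t', ht, -, h1, h2⟩ := exists_pulse_delivery hf h.chan
    have h3 : A.Reaches C ids inp σ t fun b a =>
        Pumping ids inp b a τ (o + 1) (m + 1) c K 0 := by
      refine ⟨t' + 1, by omega, ?_⟩
      rw [h1, h2, h0]
      exact hp
    exact h3.trans fun _ _ h => (h.reaches_passing hf).trans fun _ _ h => ih h (by omega)

theorem reaches_full [NeZero n] (hf : (A.oblivious C).Fair ids inp σ)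
    (hids : Function.Injective ids) (t : ℕ) :
    A.Reaches C ids inp σ t fun b a => (∃ τ o c, Passing ids inp b a τ o n c) ∨
      (∃ o d, Dying b a o d) ∨ Halted b a := by
  rcases related_run hids t with ⟨h, ha⟩ | ⟨τ, o, m, c, K, d, h⟩ | ⟨τ, o, m, c, h⟩ | ⟨o, d, h⟩ | h
  · exact (h.reaches_passing hf hids ha).trans fun _ _ ⟨_, _, _, h⟩ =>
      (h.reaches_full hf).trans fun _ _ h => .refl (Or.inl h)
  · exact (h.reaches_passing hf).trans fun _ _ h =>
      (h.reaches_full hf).trans fun _ _ h => .refl (Or.inl h)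
  · exact (h.reaches_full hf).trans fun _ _ h => .refl (Or.inl h)
  · exact .refl (Or.inr (Or.inl ⟨o, d, h⟩))
  · exact .refl (Or.inr (Or.inr h))

theorem Dying.reaches_halted [NeZero n] (hf : (A.oblivious C).Fair ids inp σ) {o : ZMod n}
    {d t : ℕ} (h : Dying ((A.oblivious C).run ids inp σ t)
      (A.run ids inp (A.simSchedule C ids inp σ) t) o d) :
    A.Reaches C ids inp σ t Halted := by
  obtain ⟨e, he⟩ : ∃ e, d + e = n := ⟨n - d, by have := h.d_le; omega⟩
  induction e generalizing d t with
  | zero =>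
    obtain ⟨t', ht, -, h1, h2⟩ := exists_pulse_delivery hf h.chan
    refine ⟨t' + 1, by omega, ?_⟩
    rw [h1, h2, h.quiescent.next_eq]
    rcases h.step with ⟨hlt, -⟩ | h
    · omega
    · exact h
  | succ e ih =>
    obtain ⟨t', ht, -, h1, h2⟩ := exists_pulse_delivery hf h.chan
    have h3 : A.Reaches C ids inp σ t fun b a => Dying b a o (d + 1) ∨ Halted b a := by
      refine ⟨t' + 1, by omega, ?_⟩
      rw [h1, h2, h.quiescent.next_eq]
      exact h.step.imp_left And.right
    refine h3.trans fun _ _ h => ?_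
    rcases h with h | h
    · exact ih h (by omega)
    · exact .refl h

/-- The token need not be complete when the simulated execution is quiescent: `reaches_full` first
leads to a complete token, and its next receiver notices the quiescence. -/
theorem reaches_halted [NeZero n] (hf : (A.oblivious C).Fair ids inp σ)
    (hids : Function.Injective ids) {t : ℕ}
    (hq : (A.run ids inp (A.simSchedule C ids inp σ) t).Quiescent) :
    A.Reaches C ids inp σ t Halted := by
  refine (reaches_full hf hids t).trans fun t' ht h => ?_
  rcases h with ⟨τ, o, c, h⟩ | ⟨o, d, h⟩ | h
  · have hq' : (A.run ids inp (A.simSchedule C ids inp σ) t').Quiescent := by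
      rwa [A.run_eq_of_quiescent hq ht]
    obtain ⟨t₁, ht₁, -, h1, h2⟩ := exists_pulse_delivery hf h.chan
    have h3 : A.Reaches C ids inp σ t' fun b a => Dying b a (o + 1) 1 ∨ Halted b a := by
      refine ⟨t₁ + 1, by omega, ?_⟩
      rw [h1, h2, hq'.next_eq]
      exact h.step_of_quiescent hq'
    refine h3.trans fun _ _ h => ?_
    rcases h with h | h
    · exact h.reaches_halted hf
    · exact .refl h
  · exact h.reaches_halted hf
  · exact .refl h

theorem port_opp_eq_of_ne {p q : Port} (h : p ≠ q) : p.opp = q := by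
  cases p <;> cases q <;> first | rfl | exact absurd rfl h

theorem fair_simSchedule [NeZero n] (hf : (A.oblivious C).Fair ids inp σ)
    (hids : Function.Injective ids) : A.Fair ids inp (A.simSchedule C ids inp σ) := by
  intro t i p hc
  by_contra! hcon
  have hne : ∀ t', t ≤ t' →
      (A.run ids inp (A.simSchedule C ids inp σ) t').chan i p ≠ [] := fun t' ht => by
    induction t', ht using Nat.le_induction with
    | base => exact hc
    | succ k hk ih => rw [run_succ]; exact A.chan_next_ne_nil ih (hcon k hk)
  have hnq : ∀ t', t ≤ t' → ¬ (A.run ids inp (A.simSchedule C ids inp σ) t').Quiescent :=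
    fun t' ht hq => hne t' ht (hq i p)
  -- The measure is the distance that the token has to travel to the receiving node, plus `n` if
  -- that node will look at the wrong port first. Every handover lowers it, since a visit with the
  -- wrong port trades `0 + n` for `n - 1`; a visit with the right port serves the channel, against
  -- `hcon`.
  have key : ∀ (e t' : ℕ) (τ : ZMod n → Port) (o : ZMod n) (c : ℕ), t ≤ t' →
      Passing ids inp ((A.oblivious C).run ids inp σ t')
        (A.run ids inp (A.simSchedule C ids inp σ) t') τ o n c →
      (neighbor i p - (o + 1)).val + (if τ (neighbor i p) = p.opp then 0 else n) = e → False := by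
    intro e
    induction e using Nat.strong_induction_on with
    | _ e ih =>
      intro t' τ o c ht h he
      obtain ⟨K, hp⟩ := h.step_of_not_quiescent (hnq t' ht)
      obtain ⟨t₁, ht₁, hs, h1, h2⟩ := exists_pulse_delivery hf h.chan
      rw [h.simEvent_eq (hnq t' ht)] at hs h2
      have hp' : Pumping ids inp ((A.oblivious C).run ids inp σ (t₁ + 1))
          (A.run ids inp (A.simSchedule C ids inp σ) (t₁ + 1))
          (Function.update τ (o + 1) (τ (o + 1)).opp) (o + 1) n c K 0 := by
        rw [h1, h2]; exact hp
      obtain ⟨t₂, ht₂, h'⟩ := hp'.reaches_passing hf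
      refine ih _ ?_ t₂ _ _ _ (by omega) h' rfl
      generalize hj : neighbor i p = j at *
      by_cases hjo : j = o + 1
      · have hτ : τ j ≠ p.opp := fun hτ => hcon t₁ (by omega) <| by
          rw [hs, ← hjo, hτ, Port.opp_opp, ← hj, neighbor_neighbor_opp]
        rw [if_neg hτ] at he
        rw [← hjo, Function.update_self, if_pos (port_opp_eq_of_ne hτ), val_sub_succ]
        have := NeZero.pos n
        omega
      · rw [Function.update_of_ne hjo]
        have e1 : j - (o + 1) = j - (o + 1 + 1) + 1 := by ring
        rw [e1, val_add_one, ← e1, if_neg (sub_ne_zero.mpr hjo)] at he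
        omega
  obtain ⟨t', ht, h⟩ := reaches_full hf hids t
  rcases h with ⟨τ, o, c, h⟩ | ⟨o, d, h⟩ | h
  · exact key _ t' τ o c ht h rfl
  · exact hnq t' ht h.quiescent
  · exact hnq t' ht h.quiescent_sim

theorem terminated_of_dead {x : NodeState A.State} (h : x.dead) :
    (A.oblivious C).Terminated x := by
  intro p _
  cases p
  · exact if_pos h
  · exact if_pos h

theorem oblivious_simulates [NeZero n] (hids : Function.Injective ids) :
    (A.oblivious C).Simulates A NodeState.sim ids inp := by
  intro σ hf
  have hfA := fair_simSchedule hf hids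
  refine ⟨A.simSchedule C ids inp σ, hfA, fun t => (related_run hids t).sim, fun ht => ?_,
    fun ⟨t, hq⟩ => ?_⟩
  -- Halted nodes are dead only if all simulated nodes have terminated, so the halting time is
  -- sought after both quiescence and termination.
  · obtain ⟨t₁, hq⟩ := ht.reachesQuiescence A hfA
    obtain ⟨t₀, ht⟩ := ht
    have hq' : (A.run ids inp (A.simSchedule C ids inp σ) (max t₀ t₁)).Quiescent := by
      rw [A.run_eq_of_quiescent hq (le_max_right _ _)]; exact hq
    obtain ⟨t, hle, h⟩ := reaches_halted hf hids hq'
    refine ⟨t, fun i => terminated_of_dead (h.dead ?_ i)⟩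
    rw [A.run_state_of_terminated ht ((le_max_left _ _).trans hle)]
    exact ht
  · obtain ⟨t', -, h⟩ := reaches_halted hf hids hq
    exact ⟨t', h.quiescent⟩

end Schedules

end RingAlgorithm

theorem corollary4 {Input : Type u} {Msg : Type v} {Output : Type w} [Countable Msg]
    (A : RingAlgorithm.{u, v, w, s} Input Msg Output) :
    ∃ (B : RingAlgorithm.{u, 0, w, s} Input Pulse Output) (sim : B.State → A.State),
      (∀ x : B.State, B.output x = A.output (sim x)) ∧
      ∀ (n : ℕ) [NeZero n] (ids : ZMod n → ℕ) (inp : ZMod n → Input),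
        Function.Injective ids → B.Simulates A sim ids inp := by
  obtain ⟨C⟩ := Coding.nonempty (List (RingAlgorithm.Entry Msg))
  exact ⟨A.oblivious C, RingAlgorithm.NodeState.sim, fun _ => rfl,
    fun n _ ids inp hids => RingAlgorithm.oblivious_simulates hids⟩
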